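/- **The model.** Fix $\alpha\in(0,1)$, $\beta\in(0,1-\alpha)$, an integer $m\ge 1$ and $p\in(0,1]$. Let $S$ be the unit cube in $\mathbb R^m$ with the $L_\infty$ torus metric. The geo-protean process on $n$ nodes is the following Markov chain. At every time $t$ there are $n$ nodes located in $S$, a graph $G_t$ on them, and a bijective ranking $r(\cdot,t)$ of them by $[n]=\{1,\dots,n\}$. The influence region $R(u,t)$ of a node $u$ is the ball around $u$ of volume $r(u,t)^{-\alpha}n^{-\beta}$. In step $t\ge 1$: (1) a new node $v$ is placed uniformly at random in $S$, and for every old node $u$ with $v\in R(u,t-1)$ the edge $vu$ is created independently with probability $p$; (2) a uniformly random old node is deleted with its edges, and every remaining old node of rank above that of the deleted one has its rank lowered by $1$; (3) $v$ obtains an initial rank $R_t$ that is uniform on $[n]$, and the old nodes whose rank is now at least $R_t$ have it raised by $1$. All random choices are independent. The age rank of a node alive is its position when the nodes alive are listed by age, oldest first. GEO-P$(\alpha,\beta,m,p)$ is the chain in its stationary distribution (the state recording, besides the positions, the ranking and the graph, also the age order of the nodes and their initial ranks). For $1\le i\le n$ let $v_i$ be the node of age rank $i$ at time $L$, let $R_i$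 be its initial rank, and for real $y$ put $$D_i(y)=p\left(\frac{i}{(1-\alpha)n}+y\,\frac{n-i}{n}\right)n^{1-\alpha-\beta}.$$ **Theorem.** There are constants $C,c>0$ and $N$, depending only on $\alpha,\beta,m,p$, such that for all $n\ge N$ and all $i\in[n]$ the following holds. Let $E_i$ be the event that both * if $R_i\ge\sqrt n\,\log^2 n$, then $\left|\deg(v_i,L)-D_i\big((R_i/n)^{-\alpha}\big)\right|\le C\,(\log n)^{-1/2}\,D_i\big((R_i/n)^{-\alpha}\big)$; * if $R_i<\sqrt n\,\log^2 n$, then $\deg(v_i,L)\ge\big(1-C(\log n)^{-1/2}\big)\,D_i\big(n^{\alpha/2}\log^{-2\alpha}n\big)$. Then (a) if the chain is in a stationary distribution, $\mathbb P(E_i)\ge 1-\exp(-c\log^2 n)$; and (b) if the chain is started at time $0$ from an arbitrary state, then for every $L\ge 0$, $\mathbb P(E_i)\ge 1-\exp(-c\log^2 n)-n\,e^{-L/n}$. -/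

import Mathlib

open MeasureTheory ProbabilityTheory

/-! ### The geo-protean model with uniform random initial rank

The model on `n = k + 1` nodes is a Markov chain.  The nodes alive are listed by age, oldest first:
the index set is `Fin (k + 1)`, index `0` is the oldest node, `Fin.last k` is the youngest, and the
node with index `j` has age rank `j + 1`.  Ranks in `[n] = {1, …, n}` are likewise stored as
elements of `Fin (k + 1)`, the rank being the stored value plus one. -/

namespace GeoP

/-- The unit hypercube in dimension `m` with opposite faces identified.  The distance is the
supremum over the coordinates of the distance on the circle of length one (the `L_∞` torus metric),
and `volume` is the uniform probability measure. -/
abbrev Torus (m : ℕ) : Type := Fin m → UnitAddCircle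

/-- The combinatorial part of a state: the current ranking (a bijection from the nodes alive to
`[n]`), the rank each node obtained at its birth, and the graph. -/
@[ext]
structure Labels (k : ℕ) where
  rank : Equiv.Perm (Fin (k + 1))
  initRank : Fin (k + 1) → Fin (k + 1)
  graph : SimpleGraph (Fin (k + 1))

instance (k : ℕ) : MeasurableSpace (Labels k) := ⊤

instance (k : ℕ) : DiscreteMeasurableSpace (Labels k) := ⟨fun _ => trivial⟩

instance (k : ℕ) : Finite (Labels k) :=
  Finite.of_injective (fun s : Labels k => (s.rank, s.initRank, s.graph)) fun s t h => by
    simp only [Prod.mk.injEq] at h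
    exact Labels.ext h.1 h.2.1 h.2.2

/-- A state of the chain: the positions of the nodes alive, and their labels. -/
abbrev State (m k : ℕ) : Type := (Fin (k + 1) → Torus m) × Labels k

/-- The rank, as an element of `{1, …, n}`. -/
def State.rk {m k : ℕ} (s : State m k) (u : Fin (k + 1)) : ℕ := (s.2.rank u : ℕ) + 1

/-- The initial rank, as an element of `{1, …, n}`. -/
def State.initRk {m k : ℕ} (s : State m k) (u : Fin (k + 1)) : ℕ := (s.2.initRank u : ℕ) + 1

/-- The degree of a node. -/
noncomputable def State.deg {m k : ℕ} (s : State m k) (u : Fin (k + 1)) : ℕ :=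
  (s.2.graph.neighborSet u).ncard

/-- The volume `r ^ (-α) * n ^ (-β)` of the influence region of a node of rank `r`. -/
noncomputable def influenceVolume (α β : ℝ) (n r : ℕ) : ℝ := (r : ℝ) ^ (-α) * (n : ℝ) ^ (-β)

/-- The influence region of a node at `x` of rank `r`: the ball around `x` whose volume is
`influenceVolume α β n r` (see `volume_influenceRegion`). -/
noncomputable def influenceRegion {m : ℕ} (α β : ℝ) (n r : ℕ) (x : Torus m) : Set (Torus m) :=
  Metric.closedBall x (influenceVolume α β n r ^ (1 / (m : ℝ)) / 2)

/-- The randomness used in one step: the position of the new node, one coin for every old node,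
the (index of the) node to be deleted, and the initial rank of the new node. -/
abbrev Noise (m k : ℕ) : Type :=
  Torus m × (Fin (k + 1) → Bool) × Fin (k + 1) × Fin (k + 1)

/-- The law of the randomness of one step: all parts are independent, the position is uniform,
the coins are Bernoulli with parameter `p`, the deleted node is uniform among the `n` old nodes,
and the initial rank is uniform on `[n]`. -/
noncomputable def noise (m k : ℕ) (p : unitInterval) : Measure (Noise m k) :=
  (volume : Measure (Torus m)).prod
    ((Measure.pi fun _ : Fin (k + 1) => bernoulliMeasure true false p).prod
      ((PMF.uniformOfFintype (Fin (k + 1))).toMeasure.prod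
        (PMF.uniformOfFintype (Fin (k + 1))).toMeasure))

/-- The ranking after node `d` is deleted and a new, youngest node is inserted with rank `R`:
the ranks above that of `d` move down by one, and then those at least `R` move up by one
(see `newRank_survivor` for the explicit formula). -/
def newRank {k : ℕ} (σ : Equiv.Perm (Fin (k + 1))) (d R : Fin (k + 1)) :
    Equiv.Perm (Fin (k + 1)) :=
  (finSuccEquiv' (Fin.last k)).trans <| (finSuccEquiv' d).symm.trans <|
    σ.trans <| (finSuccEquiv' (σ d)).trans (finSuccEquiv' R).symm

/-- The graph after a new, youngest node is joined to the nodes in `N` and node `d` is deleted.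
The survivor with new index `a` has old index `d.succAbove a`. -/
def newGraph {k : ℕ} (G : SimpleGraph (Fin (k + 1))) (N : Set (Fin (k + 1))) (d : Fin (k + 1)) :
    SimpleGraph (Fin (k + 1)) where
  Adj u v :=
    (∃ a b : Fin k, u = a.castSucc ∧ v = b.castSucc ∧ G.Adj (d.succAbove a) (d.succAbove b)) ∨
    (∃ a : Fin k, u = a.castSucc ∧ v = Fin.last k ∧ d.succAbove a ∈ N) ∨
    (∃ a : Fin k, v = a.castSucc ∧ u = Fin.last k ∧ d.succAbove a ∈ N)
  symm := ⟨by
    rintro u v (⟨a, b, h1, h2, h3⟩ | ⟨a, h⟩ | ⟨a, h⟩)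
    · exact Or.inl ⟨b, a, h2, h1, h3.symm⟩
    · exact Or.inr (Or.inr ⟨a, h⟩)
    · exact Or.inr (Or.inl ⟨a, h⟩)⟩
  loopless := ⟨by
    rintro u (⟨a, b, h1, h2, h3⟩ | ⟨a, h1, h2, _⟩ | ⟨a, h1, h2, _⟩)
    · have : a = b := Fin.castSucc_injective k (h1.symm.trans h2)
      exact G.loopless.irrefl _ (this ▸ h3)
    · exact Fin.castSucc_ne_last a (h1.symm.trans h2)
    · exact Fin.castSucc_ne_last a (h1.symm.trans h2)⟩

/-- The old nodes the new node is joined to: those whose influence region, with their rank before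
the step, contains the position of the new node, and whose coin succeeds. -/
def linked {m k : ℕ} (α β : ℝ) (s : State m k) (w : Noise m k) : Set (Fin (k + 1)) :=
  {u | w.1 ∈ influenceRegion α β (k + 1) (s.rk u) (s.1 u) ∧ w.2.1 u = true}

/-- The labels after a new, youngest node with initial rank `R` is joined to the nodes in `N`, and
node `d` is deleted. -/
def newLabels {k : ℕ} (l : Labels k) (N : Set (Fin (k + 1))) (d R : Fin (k + 1)) : Labels k where
  rank := newRank l.rank d R
  initRank := Fin.snoc (α := fun _ => Fin (k + 1)) (d.removeNth l.initRank) R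
  graph := newGraph l.graph N d

/-- One step of the chain.  The deleted node `d` is removed from the list of the nodes alive and
the new node, at position `v` and with initial rank `R`, is appended at its end. -/
def step {m k : ℕ} (α β : ℝ) (s : State m k) (w : Noise m k) : State m k :=
  let v := w.1
  let d := w.2.2.1
  let R := w.2.2.2
  (Fin.snoc (α := fun _ => Torus m) (d.removeNth s.1) v, newLabels s.2 (linked α β s w) d R)

/-- The law of the state after one more step, when the state has law `μ`. -/
noncomputable def evolve {m k : ℕ} (α β : ℝ) (p : unitInterval) (μ : Measure (State m k)) :
    Measure (State m k) :=
  (μ.prod (noise m k p)).map fun q => step α β q.1 q.2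

/-- The law of the state at time `t`, when the chain is started from the state `s`. -/
noncomputable def lawAt {m k : ℕ} (α β : ℝ) (p : unitInterval) (s : State m k) (t : ℕ) :
    Measure (State m k) :=
  (evolve α β p)^[t] (Measure.dirac s)

/-- `μ` is a stationary distribution of the chain. -/
def IsStationary {m k : ℕ} (α β : ℝ) (p : unitInterval) (μ : Measure (State m k)) : Prop :=
  IsProbabilityMeasure μ ∧ evolve α β p μ = μ

/-- The quantity `p (i / ((1 - α) n) + y (n - i) / n) n ^ (1 - α - β)`. -/
noncomputable def degreeValue (α β p n i y : ℝ) : ℝ :=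
  p * (i / ((1 - α) * n) + y * ((n - i) / n)) * n ^ (1 - α - β)

/-- The states in which the node with index `j` satisfies the degree estimates with error
constant `C`.  Here `n` is the number of nodes, `i` the age rank of the node and `R` its
initial rank. -/
def degreeEvent {m k : ℕ} (α β p C : ℝ) (j : Fin (k + 1)) : Set (State m k) :=
  {s | let n : ℝ := (k : ℝ) + 1
       let i : ℝ := (j : ℝ) + 1
       let R : ℝ := (s.initRk j : ℝ)
       let D : ℝ := (s.deg j : ℝ)
       let ε : ℝ := C * Real.log n ^ (-(1 / 2) : ℝ)
       (√n * Real.log n ^ 2 ≤ R →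
          |D - degreeValue α β p n i ((R / n) ^ (-α))| ≤
            ε * degreeValue α β p n i ((R / n) ^ (-α))) ∧
       (R < √n * Real.log n ^ 2 →
          (1 - ε) * degreeValue α β p n i (n ^ (α / 2) * Real.log n ^ (-(2 * α))) ≤ D)}

/-! ### Sanity checks -/

/-- The influence region has the prescribed volume. -/
theorem volume_influenceRegion {m : ℕ} (hm : 0 < m) {α β : ℝ} (hα : 0 ≤ α) (hβ : 0 ≤ β)
    {n r : ℕ} (hn : 1 ≤ n) (hr : 1 ≤ r) (x : Torus m) :
    volume (influenceRegion α β n r x) = ENNReal.ofReal (influenceVolume α β n r) := by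
  have hV0 : 0 ≤ influenceVolume α β n r := by unfold influenceVolume; positivity
  have hV1 : influenceVolume α β n r ≤ 1 := by
    unfold influenceVolume
    exact mul_le_one₀ (Real.rpow_le_one_of_one_le_of_nonpos (by exact_mod_cast hr) (by linarith))
      (by positivity) (Real.rpow_le_one_of_one_le_of_nonpos (by exact_mod_cast hn) (by linarith))
  set V := influenceVolume α β n r
  have h0 : 0 ≤ V ^ (1 / (m : ℝ)) := by positivity
  have h1 : V ^ (1 / (m : ℝ)) ≤ 1 := Real.rpow_le_one hV0 hV1 (by positivity)
  have hmm : (m : ℝ) ≠ 0 := by exact_mod_cast hm.ne'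
  unfold influenceRegion
  rw [closedBall_pi x (by positivity), volume_pi_pi]
  simp only [AddCircle.volume_closedBall]
  rw [Finset.prod_const, Finset.card_univ, Fintype.card_fin, mul_div_cancel₀ _ two_ne_zero,
    min_eq_right h1, ← ENNReal.ofReal_pow h0, ← Real.rpow_natCast, ← Real.rpow_mul hV0,
    one_div_mul_cancel hmm, Real.rpow_one]

theorem newRank_last {k : ℕ} (σ : Equiv.Perm (Fin (k + 1))) (d R : Fin (k + 1)) :
    newRank σ d R (Fin.last k) = R := by
  simp [newRank]

/-- The rank update of a surviving node: `r ↦ r + δ - γ`, where `γ = 1` if the deleted node had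
smaller rank, and `δ = 1` if the rank after the deletion is at least `R`. -/
theorem newRank_survivor {k : ℕ} (σ : Equiv.Perm (Fin (k + 1))) (d R : Fin (k + 1)) (a : Fin k) :
    ((newRank σ d R a.castSucc : ℕ) : ℤ) =
      let r : ℤ := ((σ (d.succAbove a) : ℕ) : ℤ)
      let γ : ℤ := if σ d < σ (d.succAbove a) then 1 else 0
      let δ : ℤ := if ((R : ℕ) : ℤ) ≤ r - γ then 1 else 0
      r + δ - γ := by
  have hne : σ (d.succAbove a) ≠ σ d := fun h => Fin.succAbove_ne d a (σ.injective h)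
  obtain ⟨b, hb⟩ := Fin.exists_succAbove_eq hne
  have h1 : newRank σ d R a.castSucc = R.succAbove b := by
    have h2 : (finSuccEquiv' (Fin.last k)) a.castSucc = some a :=
      finSuccEquiv'_last_apply_castSucc a
    simp only [newRank, Equiv.trans_apply, h2, finSuccEquiv'_symm_some]
    rw [← hb, finSuccEquiv'_succAbove, finSuccEquiv'_symm_some]
  rw [h1, ← hb]
  simp only [Fin.succAbove, Fin.lt_def]
  split_ifs <;> simp_all <;> omega

instance (m : ℕ) : IsProbabilityMeasure (volume : Measure (Torus m)) := by
  have : IsProbabilityMeasure (volume : Measure UnitAddCircle) :=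
    ⟨UnitAddCircle.measure_univ⟩
  rw [volume_pi]; infer_instance

instance (m k : ℕ) (p : unitInterval) : IsProbabilityMeasure (noise m k p) := by
  unfold noise; infer_instance

/-- The step map is measurable, so that `evolve` is a genuine push-forward. -/
theorem measurable_step {m k : ℕ} (α β : ℝ) :
    Measurable fun q : State m k × Noise m k => step α β q.1 q.2 := by
  have hd : Measurable fun q : State m k × Noise m k => q.2.2.2.1 := by fun_prop
  have hR : Measurable fun q : State m k × Noise m k => q.2.2.2.2 := by fun_prop
  have hl : Measurable fun q : State m k × Noise m k => q.1.2 := by fun_prop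
  have hx : ∀ u, Measurable fun q : State m k × Noise m k => q.1.1 u := fun u => by fun_prop
  have hv : Measurable fun q : State m k × Noise m k => q.2.1 := by fun_prop
  have hlink : Measurable fun q : State m k × Noise m k => linked α β q.1 q.2 := by
    refine measurable_set_iff.2 fun u => ?_
    refine Measurable.and ?_ ?_
    · have hρ : Measurable fun q : State m k × Noise m k =>
          influenceVolume α β (k + 1) (q.1.rk u) ^ (1 / (m : ℝ)) / 2 :=
        (Measurable.of_discrete (f := fun l : Labels k =>
          influenceVolume α β (k + 1) ((l.rank u : ℕ) + 1) ^ (1 / (m : ℝ)) / 2)).comp hl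
      exact measurableSet_setOfPred.1 (measurableSet_le (hv.dist (hx u)) hρ)
    · have hc : Measurable fun q : State m k × Noise m k => q.2.2.1 u := by fun_prop
      exact measurableSet_setOfPred.1 (hc (measurableSet_singleton true))
  refine Measurable.prodMk ?_ ?_
  · refine measurable_pi_iff.2 fun u => ?_
    induction u using Fin.lastCases with
    | last => simpa [step] using hv
    | cast a =>
      simp only [Fin.snoc_castSucc, Fin.removeNth]
      have : Measurable fun z : (State m k × Noise m k) × Fin (k + 1) => z.1.1.1 (z.2.succAbove a) :=
        measurable_from_prod_countable_left fun d => hx (d.succAbove a)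
      exact this.comp (measurable_id.prodMk hd)
  · have hz : Measurable fun q : State m k × Noise m k =>
        (q.1.2, linked α β q.1 q.2, q.2.2.2.1, q.2.2.2.2) :=
      hl.prodMk (hlink.prodMk (hd.prodMk hR))
    have hF : Measurable fun z : Labels k × Set (Fin (k + 1)) × Fin (k + 1) × Fin (k + 1) =>
        newLabels z.1 z.2.1 z.2.2.1 z.2.2.2 := Measurable.of_discrete
    have hFz := hF.comp hz
    exact hFz

theorem measurableSet_degreeEvent {m k : ℕ} (α β p C : ℝ) (j : Fin (k + 1)) :
    MeasurableSet (degreeEvent α β p C j : Set (State m k)) := by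
  let T : Set (Labels k) := {l | ((fun _ _ => 0, l) : State m k) ∈ degreeEvent α β p C j}
  have hT : MeasurableSet T := MeasurableSet.of_discrete
  have h : (degreeEvent α β p C j : Set (State m k)) = Prod.snd ⁻¹' T := by
    ext s
    simp only [T, degreeEvent, State.initRk, State.deg, Set.mem_preimage, Set.mem_ofPred_eq]
  rw [h]
  exact hT.preimage measurable_snd

instance {m k : ℕ} (α β : ℝ) (p : unitInterval) (μ : Measure (State m k))
    [IsProbabilityMeasure μ] : IsProbabilityMeasure (evolve α β p μ) :=
  Measure.isProbabilityMeasure_map (measurable_step α β).aemeasurable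

end GeoP

namespace GeoP

/-! ### Averages over sequences of deletions and initial ranks -/

/-- The part of the randomness of one step that governs the deletions and the ranks: the index of
the deleted node and the initial rank of the new node. -/
abbrev Choice (k : ℕ) : Type := Fin (k + 1) × Fin (k + 1)

/-- The average over all choices made before time `t`. -/
noncomputable def expect {k : ℕ} : ℕ → ((ℕ → Choice k) → ℝ) → ℝ
  | 0, F => F fun _ => default
  | t + 1, F => expect t fun σ =>
      (∑ a : Choice k, F (Function.update σ t a)) / ((k : ℝ) + 1) ^ 2

section expect

variable {k : ℕ}

theorem expect_succ (t : ℕ) (F : (ℕ → Choice k) → ℝ) :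
    expect (t + 1) F = expect t fun σ =>
      (∑ a : Choice k, F (Function.update σ t a)) / ((k : ℝ) + 1) ^ 2 := rfl

theorem expect_mono {F G : (ℕ → Choice k) → ℝ} (t : ℕ) (h : ∀ σ, F σ ≤ G σ) :
    expect t F ≤ expect t G := by
  induction t generalizing F G with
  | zero => exact h _
  | succ t ih =>
    refine ih fun σ => ?_
    gcongr
    exact h _

theorem expect_add (t : ℕ) (F G : (ℕ → Choice k) → ℝ) :
    expect t (fun σ => F σ + G σ) = expect t F + expect t G := by
  induction t generalizing F G with
  | zero => rfl
  | succ t ih => simp only [expect_succ, Finset.sum_add_distrib, add_div, ih]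

theorem expect_mul_left (t : ℕ) (c : ℝ) (F : (ℕ → Choice k) → ℝ) :
    expect t (fun σ => c * F σ) = c * expect t F := by
  induction t generalizing F with
  | zero => rfl
  | succ t ih => simp only [expect_succ, ← Finset.mul_sum, mul_div_assoc, ih]

theorem sum_choice_const (c : ℝ) :
    (∑ _a : Choice k, c) / ((k : ℝ) + 1) ^ 2 = c := by
  have : (k : ℝ) + 1 ≠ 0 := by positivity
  simp only [Finset.sum_const, Finset.card_univ, Fintype.card_prod, Fintype.card_fin, nsmul_eq_mul]
  push_cast
  field_simp

@[simp] theorem expect_const (t : ℕ) (c : ℝ) : expect (k := k) t (fun _ => c) = c := by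
  induction t with
  | zero => rfl
  | succ t ih => simp only [expect_succ, sum_choice_const, ih]

theorem expect_sum {ι : Type*} (t : ℕ) (A : Finset ι) (F : ι → (ℕ → Choice k) → ℝ) :
    expect t (fun σ => ∑ i ∈ A, F i σ) = ∑ i ∈ A, expect t (F i) := by
  classical
  induction A using Finset.induction_on with
  | empty => simp
  | insert i A hi ih => simp only [Finset.sum_insert hi, expect_add, ih]

/-- A function of the choices that only depends on those made before time `t`. -/
def AdaptedTo {S : Type*} (t : ℕ) (F : (ℕ → Choice k) → S) : Prop :=
  ∀ σ σ' : ℕ → Choice k, (∀ i < t, σ i = σ' i) → F σ = F σ'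

theorem AdaptedTo.update {S : Type*} {t : ℕ} {F : (ℕ → Choice k) → S} (h : AdaptedTo t F)
    {t' : ℕ} (ht : t ≤ t') (σ : ℕ → Choice k) (a : Choice k) :
    F (Function.update σ t' a) = F σ :=
  h _ _ fun i hi => Function.update_of_ne (by omega) _ _

theorem AdaptedTo.comp {S S' : Type*} {t : ℕ} {F : (ℕ → Choice k) → S} (h : AdaptedTo t F)
    (g : S → S') : AdaptedTo t fun σ => g (F σ) :=
  fun σ σ' hσ => congrArg g (h σ σ' hσ)

theorem expect_of_adaptedTo {F : (ℕ → Choice k) → ℝ} {t L : ℕ} (h : AdaptedTo t F)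
    (ht : t ≤ L) : expect L F = expect t F := by
  induction L, ht using Nat.le_induction with
  | base => rfl
  | succ L hL ih =>
    rw [expect_succ, ← ih]
    congr 1
    ext σ
    simp only [h.update hL, sum_choice_const]

end expect

/-! ### Marks and ranks of the nodes alive -/

section marks

variable {k : ℕ} {S : Type*}

/-- The marks of the nodes alive after node `d` is deleted and a node with mark `x` is appended. -/
def pushMark (f : Fin (k + 1) → S) (d : Fin (k + 1)) (x : S) : Fin (k + 1) → S :=
  Fin.snoc (α := fun _ => S) (d.removeNth f) x

@[simp] theorem pushMark_castSucc (f : Fin (k + 1) → S) (d : Fin (k + 1)) (x : S) (a : Fin k) :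
    pushMark f d x a.castSucc = f (d.succAbove a) := by
  simp [pushMark, Fin.removeNth]

@[simp] theorem pushMark_last (f : Fin (k + 1) → S) (d : Fin (k + 1)) (x : S) :
    pushMark f d x (Fin.last k) = x := by
  simp [pushMark]

theorem sum_pushMark (g : S → ℝ) (f : Fin (k + 1) → S) (d : Fin (k + 1)) (x : S) :
    ∑ u, g (pushMark f d x u) = ∑ u, g (f u) - g (f d) + g x := by
  rw [Fin.sum_univ_castSucc, Fin.sum_univ_succAbove (fun u => g (f u)) d]
  simp

/-- The marks at time `t`, when every node receives a mark at its birth. -/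
def markAt (f : Fin (k + 1) → S) (b : Choice k → S) (σ : ℕ → Choice k) : ℕ → Fin (k + 1) → S
  | 0 => f
  | t + 1 => pushMark (markAt f b σ t) (σ t).1 (b (σ t))

theorem markAt_succ (f : Fin (k + 1) → S) (b : Choice k → S) (σ : ℕ → Choice k) (t : ℕ) :
    markAt f b σ (t + 1) = pushMark (markAt f b σ t) (σ t).1 (b (σ t)) := rfl

theorem adaptedTo_markAt (f : Fin (k + 1) → S) (b : Choice k → S) (t : ℕ) :
    AdaptedTo t fun σ => markAt f b σ t := by
  induction t with
  | zero => exact fun _ _ _ => rfl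
  | succ t ih =>
    intro σ σ' h
    have h1 := ih σ σ' fun i hi => h i (by omega)
    simp only at h1
    simp only [markAt_succ, h1, h t (by omega)]

/-- The ranking at time `t`. -/
def rankAt (ρ : Equiv.Perm (Fin (k + 1))) (σ : ℕ → Choice k) : ℕ → Equiv.Perm (Fin (k + 1))
  | 0 => ρ
  | t + 1 => newRank (rankAt ρ σ t) (σ t).1 (σ t).2

theorem rankAt_succ (ρ : Equiv.Perm (Fin (k + 1))) (σ : ℕ → Choice k) (t : ℕ) :
    rankAt ρ σ (t + 1) = newRank (rankAt ρ σ t) (σ t).1 (σ t).2 := rfl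

theorem adaptedTo_rankAt (ρ : Equiv.Perm (Fin (k + 1))) (t : ℕ) :
    AdaptedTo t fun σ => rankAt ρ σ t := by
  induction t with
  | zero => exact fun _ _ _ => rfl
  | succ t ih =>
    intro σ σ' h
    have h1 := ih σ σ' fun i hi => h i (by omega)
    simp only at h1
    simp only [rankAt_succ, h1, h t (by omega)]

/-- Whether a node alive at time `t` was born after time `0`. -/
def isNew (σ : ℕ → Choice k) (t : ℕ) : Fin (k + 1) → Bool :=
  markAt (fun _ => false) (fun _ => true) σ t

theorem isNew_succ_castSucc (σ : ℕ → Choice k) (t : ℕ) (a : Fin k) :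
    isNew σ (t + 1) a.castSucc = isNew σ t ((σ t).1.succAbove a) := by
  simp [isNew, markAt_succ]

theorem isNew_succ_last (σ : ℕ → Choice k) (t : ℕ) :
    isNew σ (t + 1) (Fin.last k) = true := by
  simp [isNew, markAt_succ]

/-- The initial ranks of nodes born after time `0` do not depend on the initial marks. -/
theorem markAt_congr_of_isNew (f g : Fin (k + 1) → S) (b : Choice k → S) (σ : ℕ → Choice k)
    (t : ℕ) (u : Fin (k + 1)) (h : isNew σ t u = true) :
    markAt f b σ t u = markAt g b σ t u := by
  induction t generalizing u with
  | zero => simp [isNew, markAt] at h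
  | succ t ih =>
    induction u using Fin.lastCases with
    | last => simp [markAt_succ]
    | cast a =>
      rw [isNew_succ_castSucc] at h
      simpa [markAt_succ] using ih _ h

/-- For two nodes `u`, `v` alive at time `t`, not both born before time `0`, the rank of the older
one just before the birth of the younger one. -/
def linkRank (ρ : Equiv.Perm (Fin (k + 1))) (σ : ℕ → Choice k) :
    ℕ → Fin (k + 1) → Fin (k + 1) → Fin (k + 1)
  | 0 => fun _ _ => 0
  | t + 1 => fun u v =>
      Fin.lastCases (motive := fun _ => Fin (k + 1))
        (Fin.lastCases (motive := fun _ => Fin (k + 1)) 0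
          (fun b => rankAt ρ σ t ((σ t).1.succAbove b)) v)
        (fun a => Fin.lastCases (motive := fun _ => Fin (k + 1))
          (rankAt ρ σ t ((σ t).1.succAbove a))
          (fun b => linkRank ρ σ t ((σ t).1.succAbove a) ((σ t).1.succAbove b)) v) u

section linkRank

variable (ρ : Equiv.Perm (Fin (k + 1))) (σ : ℕ → Choice k) (t : ℕ)

theorem linkRank_succ_castSucc_castSucc (a b : Fin k) :
    linkRank ρ σ (t + 1) a.castSucc b.castSucc =
      linkRank ρ σ t ((σ t).1.succAbove a) ((σ t).1.succAbove b) := by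
  simp [linkRank]

theorem linkRank_succ_castSucc_last (a : Fin k) :
    linkRank ρ σ (t + 1) a.castSucc (Fin.last k) = rankAt ρ σ t ((σ t).1.succAbove a) := by
  simp [linkRank]

theorem linkRank_succ_last_castSucc (b : Fin k) :
    linkRank ρ σ (t + 1) (Fin.last k) b.castSucc = rankAt ρ σ t ((σ t).1.succAbove b) := by
  simp [linkRank]

end linkRank

end marks

/-! ### The law of the state, given the deletions and the initial ranks -/

section condExpect

open scoped ENNReal

variable {m k : ℕ} (α β : ℝ) (p : unitInterval)

/-- The law of the position and the coins in one step. -/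
noncomputable def placement (m k : ℕ) (p : unitInterval) :
    Measure (Torus m × (Fin (k + 1) → Bool)) :=
  (volume : Measure (Torus m)).prod (Measure.pi fun _ => bernoulliMeasure true false p)

instance (m k : ℕ) (p : unitInterval) : IsProbabilityMeasure (placement m k p) := by
  unfold placement; infer_instance

/-- The mean of `f` after one step, given the choice made in this step. -/
noncomputable def stepMean (a : Choice k) (f : State m k → ℝ≥0∞) (x : State m k) : ℝ≥0∞ :=
  ∫⁻ ξ, f (step α β x (ξ.1, ξ.2, a.1, a.2)) ∂placement m k p

/-- The mean of `f` at time `t`, given all choices, when the chain is started from `s`. -/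
noncomputable def condMean (s : State m k) (σ : ℕ → Choice k) :
    ℕ → (State m k → ℝ≥0∞) → ℝ≥0∞
  | 0, f => f s
  | t + 1, f => condMean s σ t (stepMean α β p (σ t) f)

theorem condMean_succ (s : State m k) (σ : ℕ → Choice k) (t : ℕ) (f : State m k → ℝ≥0∞) :
    condMean α β p s σ (t + 1) f = condMean α β p s σ t (stepMean α β p (σ t) f) := rfl

/-- The ranks and initial ranks of `x` are those given by the choices. -/
def Compatible (s : State m k) (σ : ℕ → Choice k) (t : ℕ) (x : State m k) : Prop :=
  x.2.rank = rankAt s.2.rank σ t ∧ x.2.initRank = markAt s.2.initRank Prod.snd σ t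

variable {α β p}

theorem Compatible.step {s : State m k} {σ : ℕ → Choice k} {t : ℕ} {x : State m k}
    (h : Compatible s σ t x) (ξ : Torus m × (Fin (k + 1) → Bool)) :
    Compatible s σ (t + 1) (step α β x (ξ.1, ξ.2, (σ t).1, (σ t).2)) := by
  refine ⟨?_, ?_⟩
  · simp [GeoP.step, newLabels, rankAt_succ, h.1]
  · simp [GeoP.step, newLabels, markAt_succ, h.2, pushMark]

variable {s : State m k} {σ : ℕ → Choice k} {t : ℕ}

theorem condMean_mono {f g : State m k → ℝ≥0∞} (h : ∀ x, Compatible s σ t x → f x ≤ g x) :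
    condMean α β p s σ t f ≤ condMean α β p s σ t g := by
  induction t generalizing f g with
  | zero => exact h s ⟨rfl, rfl⟩
  | succ t ih => exact ih fun x hx => lintegral_mono fun ξ => h _ (hx.step ξ)

theorem condMean_congr {f g : State m k → ℝ≥0∞} (h : ∀ x, Compatible s σ t x → f x = g x) :
    condMean α β p s σ t f = condMean α β p s σ t g :=
  le_antisymm (condMean_mono fun x hx => (h x hx).le) (condMean_mono fun x hx => (h x hx).ge)

theorem condMean_mul_const {f : State m k → ℝ≥0∞} {c : ℝ≥0∞} (hc : c ≠ ⊤) :
    condMean α β p s σ t (fun x => f x * c) = condMean α β p s σ t f * c := by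
  induction t generalizing f with
  | zero => rfl
  | succ t ih =>
    rw [condMean_succ, condMean_succ, ← ih]
    congr 1
    ext x
    exact lintegral_mul_const' _ _ hc

variable (α β p s σ t) in
theorem condMean_const (c : ℝ≥0∞) : condMean α β p s σ t (fun _ => c) = c := by
  induction t with
  | zero => rfl
  | succ t ih =>
    rw [condMean_succ]
    convert ih using 2
    ext x
    simp [stepMean]

theorem measurable_step_choice (a : Choice k) :
    Measurable fun q : State m k × Torus m × (Fin (k + 1) → Bool) =>
      step α β q.1 (q.2.1, q.2.2, a.1, a.2) :=
  (measurable_step α β).comp (g := fun q : State m k × Noise m k => step α β q.1 q.2)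
    (f := fun q : State m k × Torus m × (Fin (k + 1) → Bool) => (q.1, q.2.1, q.2.2, a.1, a.2))
    (by fun_prop)

theorem measurable_stepMean_param {X : Type*} [MeasurableSpace X] (a : Choice k)
    {f : X → State m k → ℝ≥0∞} (hf : Measurable (Function.uncurry f)) :
    Measurable (Function.uncurry fun y => stepMean α β p a (f y)) := by
  refine Measurable.lintegral_prod_right'
    (f := fun z : (X × State m k) × Torus m × (Fin (k + 1) → Bool) =>
      f z.1.1 (step α β z.1.2 (z.2.1, z.2.2, a.1, a.2))) ?_
  have h1 : Measurable fun z : (X × State m k) × Torus m × (Fin (k + 1) → Bool) =>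
      (z.1.2, z.2) := by fun_prop
  exact hf.comp (Measurable.prodMk (by fun_prop) ((measurable_step_choice a).comp h1))

theorem measurable_stepMean (a : Choice k) {f : State m k → ℝ≥0∞} (hf : Measurable f) :
    Measurable (stepMean α β p a f) :=
  Measurable.lintegral_prod_right' (hf.comp (measurable_step_choice a))

theorem condMean_add {f g : State m k → ℝ≥0∞} (hf : Measurable f) :
    condMean α β p s σ t (fun x => f x + g x) =
      condMean α β p s σ t f + condMean α β p s σ t g := by
  induction t generalizing f g with
  | zero => rfl
  | succ t ih =>
    rw [condMean_succ, condMean_succ, condMean_succ, ← ih (measurable_stepMean _ hf)]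
    congr 1
    ext x
    exact lintegral_add_left
      ((hf.comp (measurable_step_choice _)).comp measurable_prodMk_left) _

theorem condMean_lintegral {X : Type*} [MeasurableSpace X] (μ : Measure X) [SFinite μ]
    {f : X → State m k → ℝ≥0∞} (hf : Measurable (Function.uncurry f)) :
    condMean α β p s σ t (fun x => ∫⁻ y, f y x ∂μ) =
      ∫⁻ y, condMean α β p s σ t (f y) ∂μ := by
  induction t generalizing f with
  | zero => rfl
  | succ t ih =>
    simp only [condMean_succ]
    rw [← ih (measurable_stepMean_param _ hf)]
    congr 1
    ext x
    refine lintegral_lintegral_swap (Measurable.aemeasurable ?_)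
    have h1 : Measurable fun z : (Torus m × (Fin (k + 1) → Bool)) × X => (x, z.1) := by fun_prop
    exact hf.comp (Measurable.prodMk (by fun_prop) ((measurable_step_choice _).comp h1))

theorem condMean_congr_choice {σ' : ℕ → Choice k} {f : State m k → ℝ≥0∞}
    (h : ∀ i < t, σ i = σ' i) : condMean α β p s σ t f = condMean α β p s σ' t f := by
  induction t generalizing f with
  | zero => rfl
  | succ t ih =>
    rw [condMean_succ, condMean_succ, h t (by omega)]
    exact ih fun i hi => h i (by omega)

theorem adaptedTo_condMean (f : State m k → ℝ≥0∞) :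
    AdaptedTo t fun σ => condMean α β p s σ t f :=
  fun _ _ h => condMean_congr_choice h

theorem condMean_le_one {f : State m k → ℝ≥0∞} (hf : ∀ x, f x ≤ 1) :
    condMean α β p s σ t f ≤ 1 :=
  (condMean_mono fun x _ => hf x).trans_eq (condMean_const α β p s σ t 1)

/-! ### Averaging over the choices -/

/-- The mean of `f` after one step. -/
noncomputable def stepMeanFull (α β : ℝ) (p : unitInterval) (f : State m k → ℝ≥0∞)
    (x : State m k) : ℝ≥0∞ :=
  ∫⁻ w, f (step α β x w) ∂noise m k p

theorem measurable_stepMeanFull {f : State m k → ℝ≥0∞} (hf : Measurable f) :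
    Measurable (stepMeanFull α β p f) :=
  Measurable.lintegral_prod_right' (hf.comp (measurable_step α β))

theorem lintegral_evolve {μ : Measure (State m k)} [SFinite μ] {f : State m k → ℝ≥0∞}
    (hf : Measurable f) :
    ∫⁻ x, f x ∂evolve α β p μ = ∫⁻ x, stepMeanFull α β p f x ∂μ := by
  rw [evolve, lintegral_map hf (measurable_step α β),
    lintegral_prod (fun q : State m k × Noise m k => f (step α β q.1 q.2))
      (hf.comp (measurable_step α β)).aemeasurable]
  rfl

theorem lintegral_uniformOfFintype {A : Type*} [Fintype A] [Nonempty A] [MeasurableSpace A]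
    [DiscreteMeasurableSpace A] (f : A → ℝ≥0∞) :
    ∫⁻ a, f a ∂(PMF.uniformOfFintype A).toMeasure =
      ∑ a, f a * (Fintype.card A : ℝ≥0∞)⁻¹ := by
  rw [lintegral_fintype]
  refine Finset.sum_congr rfl fun a _ => ?_
  rw [PMF.toMeasure_apply_singleton _ _ (MeasurableSet.singleton a),
    PMF.uniformOfFintype_apply]

theorem stepMeanFull_eq {f : State m k → ℝ≥0∞} (hf : Measurable f) (x : State m k) :
    stepMeanFull α β p f x =
      (∑ a : Choice k, stepMean α β p a f x) * (((k : ℝ≥0∞) + 1) ^ 2)⁻¹ := by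
  have hg : Measurable fun w => f (step α β x w) :=
    (hf.comp (measurable_step α β)).comp measurable_prodMk_left
  have h1 : ∀ a : Choice k, Measurable fun ξ : Torus m × (Fin (k + 1) → Bool) =>
      f (step α β x (ξ.1, ξ.2, a.1, a.2)) := fun a =>
    hf.comp ((measurable_step_choice a).comp measurable_prodMk_left)
  have h2 : ∀ a : Choice k, stepMean α β p a f x =
      ∫⁻ v, ∫⁻ c, f (step α β x (v, c, a.1, a.2))
        ∂(Measure.pi fun _ : Fin (k + 1) => bernoulliMeasure true false p) := fun a => by
    rw [stepMean, placement, lintegral_prod _ (h1 a).aemeasurable]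
  have h3 : ∀ v c, (∫⁻ z, f (step α β x (v, c, z))
      ∂((PMF.uniformOfFintype (Fin (k + 1))).toMeasure.prod
        (PMF.uniformOfFintype (Fin (k + 1))).toMeasure)) =
      ∑ a : Choice k, f (step α β x (v, c, a.1, a.2)) * (((k : ℝ≥0∞) + 1) ^ 2)⁻¹ := by
    intro v c
    rw [lintegral_prod _ (Measurable.of_discrete
      (f := fun z : Choice k => f (step α β x (v, c, z)))).aemeasurable,
      lintegral_uniformOfFintype, Fintype.sum_prod_type]
    simp only [lintegral_uniformOfFintype, Fintype.card_fin]
    refine Finset.sum_congr rfl fun a _ => ?_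
    rw [Finset.sum_mul]
    refine Finset.sum_congr rfl fun b _ => ?_
    push_cast
    rw [mul_assoc, ← ENNReal.mul_inv (by simp) (by simp), sq]
  rw [stepMeanFull, noise, lintegral_prod _ hg.aemeasurable, Finset.sum_mul]
  simp only [h2]
  have h4 : ∀ a : Choice k, Measurable fun v : Torus m =>
      ∫⁻ c, f (step α β x (v, c, a.1, a.2))
        ∂(Measure.pi fun _ : Fin (k + 1) => bernoulliMeasure true false p) := fun a =>
    (h1 a).lintegral_prod_right'
  have h5 : ∀ a : Choice k, (∫⁻ v : Torus m, ∫⁻ c, f (step α β x (v, c, a.1, a.2))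
        ∂(Measure.pi fun _ : Fin (k + 1) => bernoulliMeasure true false p)) *
          (((k : ℝ≥0∞) + 1) ^ 2)⁻¹ =
      ∫⁻ v : Torus m, (∫⁻ c, f (step α β x (v, c, a.1, a.2))
        ∂(Measure.pi fun _ : Fin (k + 1) => bernoulliMeasure true false p)) *
          (((k : ℝ≥0∞) + 1) ^ 2)⁻¹ := fun a => (lintegral_mul_const _ (h4 a)).symm
  simp only [h5]
  rw [← lintegral_finsetSum _ fun a _ => (h4 a).mul_const _]
  refine lintegral_congr fun v => ?_
  have hgv : Measurable fun y => f (step α β x (v, y)) := hg.comp measurable_prodMk_left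
  rw [lintegral_prod _ hgv.aemeasurable]
  simp only [h3]
  rw [lintegral_finsetSum]
  · refine Finset.sum_congr rfl fun a _ => ?_
    exact lintegral_mul_const _ ((h1 a).comp measurable_prodMk_left)
  · intro a _
    exact ((h1 a).comp measurable_prodMk_left).mul_const _

theorem condMean_sum {ι : Type*} (A : Finset ι) {f : ι → State m k → ℝ≥0∞}
    (hf : ∀ i, Measurable (f i)) :
    condMean α β p s σ t (fun x => ∑ i ∈ A, f i x) = ∑ i ∈ A, condMean α β p s σ t (f i) := by
  classical
  induction A using Finset.induction_on with
  | empty => simpa using condMean_const α β p s σ t 0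
  | insert i A hi ih => simp only [Finset.sum_insert hi, condMean_add (hf i), ih]

instance isProbabilityMeasure_lawAt (s : State m k) (t : ℕ) :
    IsProbabilityMeasure (lawAt α β p s t) := by
  induction t with
  | zero => exact inferInstanceAs (IsProbabilityMeasure (Measure.dirac s))
  | succ t ih =>
    rw [lawAt, Function.iterate_succ_apply']
    exact inferInstanceAs (IsProbabilityMeasure (evolve α β p (lawAt α β p s t)))

theorem lawAt_succ (s : State m k) (t : ℕ) :
    lawAt α β p s (t + 1) = evolve α β p (lawAt α β p s t) := by
  rw [lawAt, Function.iterate_succ_apply']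
  rfl

theorem toReal_lintegral_lawAt (s : State m k) (t : ℕ) {f : State m k → ℝ≥0∞}
    (hf : Measurable f) (hf1 : ∀ x, f x ≤ 1) :
    (∫⁻ x, f x ∂lawAt α β p s t).toReal =
      expect t fun σ => (condMean α β p s σ t f).toReal := by
  induction t generalizing f with
  | zero => simp [lawAt, expect, condMean, lintegral_dirac' _ hf]
  | succ t ih =>
    rw [lawAt_succ, lintegral_evolve hf, ih (measurable_stepMeanFull hf), expect_succ]
    · congr 1
      ext σ
      have h1 : ∀ a : Choice k, condMean α β p s (Function.update σ t a) (t + 1) f =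
          condMean α β p s σ t (stepMean α β p a f) := fun a => by
        rw [condMean_succ, Function.update_self]
        exact (adaptedTo_condMean _).update le_rfl σ a
      simp only [h1]
      have h2 : stepMeanFull α β p f = fun x =>
          (∑ a : Choice k, stepMean α β p a f x) * (((k : ℝ≥0∞) + 1) ^ 2)⁻¹ :=
        funext fun x => stepMeanFull_eq hf x
      rw [h2, condMean_mul_const (by simp), condMean_sum _ fun a => measurable_stepMean a hf,
        ENNReal.toReal_mul, ENNReal.toReal_sum, ENNReal.toReal_inv, ENNReal.toReal_pow,
        ENNReal.toReal_add (by simp) (by simp)]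
      · simp [div_eq_mul_inv]
      · intro a _
        refine ((condMean_le_one fun x => ?_).trans_lt ENNReal.one_lt_top).ne
        exact (lintegral_mono fun ξ => hf1 _).trans_eq (by simp)
    · intro x
      exact (lintegral_mono fun ξ => hf1 _).trans_eq (by simp)

/-- The mean of `f` after `t` steps. -/
theorem lintegral_iterate_evolve (μ : Measure (State m k)) [IsProbabilityMeasure μ] (t : ℕ)
    {f : State m k → ℝ≥0∞} (hf : Measurable f) :
    ∫⁻ x, f x ∂(evolve α β p)^[t] μ = ∫⁻ x, (stepMeanFull α β p)^[t] f x ∂μ := by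
  induction t generalizing μ with
  | zero => rfl
  | succ t ih =>
    have hm : ∀ t, Measurable ((stepMeanFull α β p)^[t] f) := fun t => by
      induction t with
      | zero => exact hf
      | succ t ih =>
        rw [Function.iterate_succ_apply']
        exact measurable_stepMeanFull ih
    rw [Function.iterate_succ_apply, ih, lintegral_evolve (hm t),
      Function.iterate_succ_apply']

/-- A bound for the law at time `t` from every deterministic state holds from every initial
distribution. -/
theorem iterate_evolve_real_le (μ : Measure (State m k)) [IsProbabilityMeasure μ] (t : ℕ)
    {B : Set (State m k)} (hB : MeasurableSet B) {ε : ℝ}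
    (h : ∀ s, (lawAt α β p s t).real B ≤ ε) : ((evolve α β p)^[t] μ).real B ≤ ε := by
  have hm : Measurable (B.indicator (1 : State m k → ℝ≥0∞)) := measurable_one.indicator hB
  obtain ⟨s₀⟩ : Nonempty (State m k) := by
    by_contra hne
    rw [not_nonempty_iff] at hne
    exact absurd (measure_univ (μ := μ)) (by simp [Set.univ_eq_empty_iff.2 hne])
  have hε : 0 ≤ ε := measureReal_nonneg.trans (h s₀)
  refine ENNReal.toReal_le_of_le_ofReal hε ?_
  rw [← lintegral_indicator_one hB, lintegral_iterate_evolve μ t hm]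
  calc _ ≤ ∫⁻ _, ENNReal.ofReal ε ∂μ := lintegral_mono fun s => ?_
    _ = _ := by simp
  have h1 : (lawAt α β p s t) B ≤ ENNReal.ofReal ε :=
    (ENNReal.le_ofReal_iff_toReal_le (measure_ne_top _ _) hε).2 (h s)
  have hm' : ∀ t, Measurable ((stepMeanFull α β p)^[t] (B.indicator (1 : State m k → ℝ≥0∞))) :=
    fun t => by
      induction t with
      | zero => exact hm
      | succ t ih =>
        rw [Function.iterate_succ_apply']
        exact measurable_stepMeanFull ih
  rwa [← lintegral_indicator_one hB, lawAt, lintegral_iterate_evolve _ t hm,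
    lintegral_dirac' _ (hm' t)] at h1

end condExpect
/-! ### The generating function of the degree, given the choices -/

section newGraph

variable {k : ℕ} (G : SimpleGraph (Fin (k + 1))) (N : Set (Fin (k + 1))) (d : Fin (k + 1))

theorem newGraph_adj_castSucc_castSucc (a b : Fin k) :
    (newGraph G N d).Adj a.castSucc b.castSucc ↔ G.Adj (d.succAbove a) (d.succAbove b) := by
  simp [newGraph, Fin.castSucc_ne_last]

theorem newGraph_adj_castSucc_last (a : Fin k) :
    (newGraph G N d).Adj a.castSucc (Fin.last k) ↔ d.succAbove a ∈ N := by
  simp [newGraph, Fin.castSucc_ne_last, (Fin.castSucc_ne_last _).symm]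

theorem newGraph_adj_last_castSucc (b : Fin k) :
    (newGraph G N d).Adj (Fin.last k) b.castSucc ↔ d.succAbove b ∈ N := by
  rw [SimpleGraph.adj_comm, newGraph_adj_castSucc_last]

end newGraph

section genFun

open scoped ENNReal

variable {m k : ℕ} {α β : ℝ} {p : unitInterval}

/-- The probability that a new node is joined to a node of rank `ρ + 1`. -/
noncomputable def linkProb (α β : ℝ) (p : unitInterval) (ρ : Fin (k + 1)) : ℝ :=
  p * influenceVolume α β (k + 1) ((ρ : ℕ) + 1)

theorem influenceVolume_nonneg (α β : ℝ) (n r : ℕ) : 0 ≤ influenceVolume α β n r := by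
  unfold influenceVolume; positivity

theorem influenceVolume_le_one (hα : 0 ≤ α) (hβ : 0 ≤ β) {n r : ℕ} (hn : 1 ≤ n) (hr : 1 ≤ r) :
    influenceVolume α β n r ≤ 1 := by
  unfold influenceVolume
  exact mul_le_one₀ (Real.rpow_le_one_of_one_le_of_nonpos (by exact_mod_cast hr) (by linarith))
    (by positivity) (Real.rpow_le_one_of_one_le_of_nonpos (by exact_mod_cast hn) (by linarith))

theorem linkProb_nonneg (ρ : Fin (k + 1)) : 0 ≤ linkProb α β p ρ :=
  mul_nonneg p.2.1 (influenceVolume_nonneg ..)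

theorem linkProb_le_one (hα : 0 ≤ α) (hβ : 0 ≤ β) (ρ : Fin (k + 1)) : linkProb α β p ρ ≤ 1 :=
  mul_le_one₀ p.2.2 (influenceVolume_nonneg ..)
    (influenceVolume_le_one hα hβ (by omega) (by omega))

theorem lintegral_bernoulliMeasure (p : unitInterval) (h : Bool → ℝ≥0∞) :
    ∫⁻ b, h b ∂bernoulliMeasure true false p =
      ENNReal.ofReal p * h true + ENNReal.ofReal (1 - p) * h false := by
  rw [bernoulliMeasure_def, lintegral_add_measure, lintegral_smul_measure, lintegral_smul_measure,
    lintegral_dirac, lintegral_dirac]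
  have h1 : ((unitInterval.toNNReal p : NNReal) : ℝ≥0∞) = ENNReal.ofReal p := by
    rw [ENNReal.ofReal, Real.toNNReal_of_nonneg p.2.1]; rfl
  have h2 : ((unitInterval.toNNReal (unitInterval.symm p) : NNReal) : ℝ≥0∞) =
      ENNReal.ofReal (1 - p) := by
    rw [ENNReal.ofReal, Real.toNNReal_of_nonneg (by linarith [p.2.2])]; rfl
  rw [← h1, ← h2]
  rfl

theorem ofReal_affine {P A : ℝ} (hP0 : 0 ≤ P) (hP1 : P ≤ 1) (hA : 0 ≤ A) :
    ENNReal.ofReal P * ENNReal.ofReal A + ENNReal.ofReal (1 - P) =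
      ENNReal.ofReal (1 + (A - 1) * P) := by
  rw [← ENNReal.ofReal_mul hP0, ← ENNReal.ofReal_add (by positivity) (by linarith)]
  congr 1
  ring

theorem lintegral_coin (p : unitInterval) {A : ℝ} (hA : 0 ≤ A) (P : Prop) [Decidable P] :
    ∫⁻ b, (if P ∧ b = true then ENNReal.ofReal A else 1) ∂bernoulliMeasure true false p =
      if P then ENNReal.ofReal (1 + (A - 1) * p) else 1 := by
  rw [lintegral_bernoulliMeasure]
  by_cases h : P
  · simp [h, ofReal_affine p.2.1 p.2.2 hA]
  · have := ofReal_affine p.2.1 p.2.2 zero_le_one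
    simp only [ENNReal.ofReal_one, sub_self, zero_mul, add_zero, mul_one] at this
    simp [h, this]

theorem lintegral_coins (p : unitInterval) {A : Fin (k + 1) → ℝ} (hA : ∀ u, 0 ≤ A u)
    (P : Fin (k + 1) → Prop) [DecidablePred P] :
    ∫⁻ c, (∏ u, if P u ∧ c u = true then ENNReal.ofReal (A u) else 1)
        ∂(Measure.pi fun _ : Fin (k + 1) => bernoulliMeasure true false p) =
      ∏ u, if P u then ENNReal.ofReal (1 + (A u - 1) * p) else 1 := by
  have h := lintegral_prod_eq_prod_lintegral_of_indepFun Finset.univ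
    (fun u (c : Fin (k + 1) → Bool) => if P u ∧ c u = true then ENNReal.ofReal (A u) else 1)
    (iIndepFun_pi (μ := fun _ : Fin (k + 1) => bernoulliMeasure true false p)
      (X := fun u b => if P u ∧ b = true then ENNReal.ofReal (A u) else (1 : ℝ≥0∞))
      fun u => Measurable.of_discrete.aemeasurable)
    (fun u => Measurable.of_discrete)
  rw [h]
  refine Finset.prod_congr rfl fun u _ => ?_
  rw [← lintegral_coin p (hA u)]
  exact (measurePreserving_eval (fun _ : Fin (k + 1) => bernoulliMeasure true false p) u).lintegral_comp
    (f := fun b => if P u ∧ b = true then ENNReal.ofReal (A u) else (1 : ℝ≥0∞))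
    Measurable.of_discrete

theorem lintegral_ite_mem {X : Type*} [MeasurableSpace X] {μ : Measure X} [IsProbabilityMeasure μ]
    {B : Set X} (hB : MeasurableSet B) [DecidablePred (· ∈ B)] {V A : ℝ} (hV0 : 0 ≤ V)
    (hV1 : V ≤ 1) (hV : μ B = ENNReal.ofReal V) (hA : 0 ≤ A) :
    ∫⁻ x, (if x ∈ B then ENNReal.ofReal A else 1) ∂μ = ENNReal.ofReal (1 + (A - 1) * V) := by
  have h1 : (fun x => if x ∈ B then ENNReal.ofReal A else 1) =
      fun x => B.indicator (fun _ => ENNReal.ofReal A) x + Bᶜ.indicator (fun _ => 1) x := by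
    ext x
    by_cases hx : x ∈ B <;> simp [hx]
  rw [h1, lintegral_add_left (measurable_const.indicator hB), lintegral_indicator_const hB,
    lintegral_indicator_const hB.compl, prob_compl_eq_one_sub hB, hV, one_mul,
    ← ENNReal.ofReal_one, ← ENNReal.ofReal_sub _ hV0, mul_comm, ofReal_affine hV0 hV1 hA]

theorem lintegral_mem_influenceRegion (hm : 0 < m) (hα : 0 ≤ α) (hβ : 0 ≤ β)
    (ρ : Fin (k + 1)) (x : Torus m) {A : ℝ} (hA : 0 ≤ A)
    [DecidablePred (· ∈ influenceRegion α β (k + 1) (ρ + 1) x)] :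
    ∫⁻ y, (if y ∈ influenceRegion α β (k + 1) (ρ + 1) x then
        ENNReal.ofReal (1 + (A - 1) * p) else 1) = ENNReal.ofReal (1 + (A - 1) * linkProb α β p ρ) := by
  have hB : MeasurableSet (influenceRegion α β (k + 1) (ρ + 1) x) :=
    Metric.isClosed_closedBall.measurableSet
  rw [lintegral_ite_mem hB (influenceVolume_nonneg α β _ _)
    (influenceVolume_le_one hα hβ (by omega) (by omega))
    (volume_influenceRegion hm hα hβ (by omega) (by omega) x)]
  · unfold linkProb
    congr 1
    ring
  · nlinarith [p.2.1, p.2.2]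

theorem mem_influenceRegion_comm (α β : ℝ) (n r : ℕ) (x y : Torus m) :
    x ∈ influenceRegion α β n r y ↔ y ∈ influenceRegion α β n r x :=
  Metric.mem_closedBall_comm

open scoped Classical in
/-- The positions of the nodes born after time `0` are independent and uniform. -/
theorem condMean_prod_pos (s : State m k) (σ : ℕ → Choice k) (t : ℕ)
    (h : Fin (k + 1) → Torus m → ℝ≥0∞) (hm : ∀ u, Measurable (h u))
    (hh : ∀ u x, h u x ≠ ⊤) (hi : ∀ u, ∫⁻ y, h u y ≠ ⊤) :
    condMean α β p s σ t (fun x => ∏ u, if isNew σ t u then h u (x.1 u) else 1) =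
      ∏ u, if isNew σ t u then ∫⁻ y, h u y else 1 := by
  induction t generalizing h with
  | zero => simp [condMean, isNew, markAt]
  | succ t ih =>
    set d := (σ t).1 with hd
    have hstep : ∀ x : State m k,
        stepMean α β p (σ t) (fun x => ∏ u, if isNew σ (t + 1) u then h u (x.1 u) else 1) x =
        (∏ u, if isNew σ t u then
          (Fin.insertNth (α := fun _ => Torus m → ℝ≥0∞) d (fun _ => 1)
            (fun b => h b.castSucc)) u (x.1 u) else 1) * ∫⁻ y, h (Fin.last k) y := by
      intro x
      have h1 : ∀ ξ : Torus m × (Fin (k + 1) → Bool),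
          (∏ u, if isNew σ (t + 1) u then
            h u ((step α β x (ξ.1, ξ.2, (σ t).1, (σ t).2)).1 u) else 1) =
          (∏ u, if isNew σ t u then
          (Fin.insertNth (α := fun _ => Torus m → ℝ≥0∞) d (fun _ => 1)
            (fun b => h b.castSucc)) u (x.1 u) else 1) * h (Fin.last k) ξ.1 := by
        intro ξ
        rw [Fin.prod_univ_castSucc, Fin.prod_univ_succAbove _ d]
        simp [isNew_succ_castSucc, isNew_succ_last, step, Fin.removeNth, hd]
      rw [stepMean]
      simp only [h1]
      rw [lintegral_const_mul']
      · congr 1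
        exact (measurePreserving_fst (μ := (volume : Measure (Torus m)))
          (ν := Measure.pi fun _ : Fin (k + 1) => bernoulliMeasure true false p)).lintegral_comp
          (hm _)
      · refine (ENNReal.prod_lt_top fun u _ => ?_).ne
        split_ifs
        · induction u using d.succAboveCases with
          | x => simp
          | p b => simpa using (hh _ _).lt_top
        · simp
    rw [condMean_succ, condMean_congr fun x _ => hstep x, condMean_mul_const (hi _), ih]
    · rw [Fin.prod_univ_succAbove _ d, Fin.prod_univ_castSucc]
      simp [isNew_succ_castSucc, isNew_succ_last, hd]
    · intro u
      induction u using d.succAboveCases with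
      | x => simp
      | p b => simpa using hm _
    · intro u
      induction u using d.succAboveCases with
      | x => simp
      | p b => simpa using hh _
    · intro u
      induction u using d.succAboveCases with
      | x => simp
      | p b => simpa using hi _

theorem rk_of_compatible {s x : State m k} {σ : ℕ → Choice k} {t : ℕ} (h : Compatible s σ t x)
    (u : Fin (k + 1)) : x.rk u = (rankAt s.2.rank σ t u : ℕ) + 1 := by
  rw [State.rk, h.1]

open scoped Classical in
/-- The generating function of the links from a new node to the older nodes born after time `0`. -/
theorem condMean_prod_linked (hm : 0 < m) (hα : 0 ≤ α) (hβ : 0 ≤ β) (s : State m k)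
    (σ : ℕ → Choice k) (t : ℕ) {A : Fin (k + 1) → ℝ} (hA : ∀ u, 0 ≤ A u) :
    condMean α β p s σ t (fun x => ∫⁻ ξ, (∏ u, if isNew σ t u ∧
        u ∈ linked α β x (ξ.1, ξ.2, (σ t).1, (σ t).2) then ENNReal.ofReal (A u) else 1)
          ∂placement m k p) =
      ∏ u, if isNew σ t u then
        ENNReal.ofReal (1 + (A u - 1) * linkProb α β p (rankAt s.2.rank σ t u)) else 1 := by
  have hA' : ∀ u, 0 ≤ 1 + (A u - 1) * (p : ℝ) := fun u => by nlinarith [p.2.1, p.2.2, hA u]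
  let H : Torus m → Fin (k + 1) → Torus m → ℝ≥0∞ := fun v u y =>
    if v ∈ influenceRegion α β (k + 1) ((rankAt s.2.rank σ t u : ℕ) + 1) y then
      ENNReal.ofReal (1 + (A u - 1) * p) else 1
  have hH : ∀ u, Measurable (Function.uncurry fun v y => H v u y) := fun u => by
    refine Measurable.ite ?_ measurable_const measurable_const
    exact measurableSet_le (measurable_fst.dist measurable_snd) measurable_const
  have h1 : ∀ x, Compatible s σ t x →
      (∫⁻ ξ, (∏ u, if isNew σ t u ∧
        u ∈ linked α β x (ξ.1, ξ.2, (σ t).1, (σ t).2) then ENNReal.ofReal (A u) else 1)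
          ∂placement m k p) = ∫⁻ v, ∏ u, if isNew σ t u then H v u (x.1 u) else 1 := by
    intro x hx
    have hlk : ∀ (ξ : Torus m × (Fin (k + 1) → Bool)) (u : Fin (k + 1)), (isNew σ t u ∧
        u ∈ linked α β x (ξ.1, ξ.2, (σ t).1, (σ t).2)) ↔ ((isNew σ t u ∧
          ξ.1 ∈ influenceRegion α β (k + 1) ((rankAt s.2.rank σ t u : ℕ) + 1) (x.1 u)) ∧
            ξ.2 u = true) := fun ξ u => by
      simp only [linked, rk_of_compatible hx, Set.mem_ofPred_eq, and_assoc]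
    simp only [hlk]
    rw [placement, lintegral_prod]
    · refine lintegral_congr fun v => ?_
      simp only
      rw [lintegral_coins p hA (fun u => (isNew σ t u : Prop) ∧
          v ∈ influenceRegion α β (k + 1) ((rankAt s.2.rank σ t u : ℕ) + 1) (x.1 u))]
      refine Finset.prod_congr rfl fun u _ => ?_
      by_cases hu : isNew σ t u <;> simp [hu, H]
    · refine (Finset.measurable_prod _ fun u _ => ?_).aemeasurable
      refine Measurable.ite ?_ measurable_const measurable_const
      refine MeasurableSet.inter (MeasurableSet.inter (MeasurableSet.const _) ?_) ?_
      · exact measurableSet_le (measurable_fst.dist measurable_const) measurable_const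
      · have hc : Measurable fun q : Torus m × (Fin (k + 1) → Bool) => q.2 u := by fun_prop
        exact hc (measurableSet_singleton true)
  rw [condMean_congr h1, condMean_lintegral]
  · have h2 : ∀ v, condMean α β p s σ t
        (fun x => ∏ u, if isNew σ t u then H v u (x.1 u) else 1) =
        ∏ u, if isNew σ t u then
          ENNReal.ofReal (1 + (A u - 1) * linkProb α β p (rankAt s.2.rank σ t u)) else 1 := by
      intro v
      have h3 : ∀ u, ∫⁻ y, H v u y =
          ENNReal.ofReal (1 + (A u - 1) * linkProb α β p (rankAt s.2.rank σ t u)) := fun u => by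
        simp only [H, mem_influenceRegion_comm α β _ _ v]
        exact lintegral_mem_influenceRegion hm hα hβ _ v (hA u)
      refine (condMean_prod_pos s σ t (H v) ?_ ?_ ?_).trans ?_
      rotate_right
      · simp only [h3]
      · exact fun u => Measurable.of_uncurry_left (hH u)
      · intro u x
        simp only [H]
        split_ifs <;> simp
      · intro u
        rw [h3]
        exact ENNReal.ofReal_ne_top
    simp [h2]
  · have h4 : ∀ u, Measurable fun z : Torus m × State m k => H z.1 u (z.2.1 u) := fun u =>
      (hH u).comp (f := fun z : Torus m × State m k => (z.1, z.2.1 u)) (by fun_prop)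
    have h5 : Measurable fun z : Torus m × State m k =>
        ∏ u, if isNew σ t u then H z.1 u (z.2.1 u) else 1 := by
      refine Finset.measurable_prod _ fun u _ => ?_
      by_cases hu : isNew σ t u
      · simpa only [hu, if_true] using h4 u
      · simp [hu]
    exact h5

/-- The probability that two nodes alive are joined. -/
noncomputable def edgeProb (α β : ℝ) (p : unitInterval) (ρ : Equiv.Perm (Fin (k + 1)))
    (σ : ℕ → Choice k) (t : ℕ) (u v : Fin (k + 1)) : ℝ :=
  if u = v then 0 else linkProb α β p (linkRank ρ σ t u v)

open scoped Classical in
/-- Given the choices, a node is joined independently to the other nodes born after time `0`. -/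
theorem condMean_prod_adj (hm : 0 < m) (hα : 0 ≤ α) (hβ : 0 ≤ β) (s : State m k)
    (σ : ℕ → Choice k) (t : ℕ) (v : Fin (k + 1)) (hv : isNew σ t v)
    {A : Fin (k + 1) → ℝ} (hA : ∀ u, 0 ≤ A u) :
    condMean α β p s σ t (fun x => ∏ u, if isNew σ t u ∧ x.2.graph.Adj u v then
        ENNReal.ofReal (A u) else 1) =
      ∏ u, if isNew σ t u then
        ENNReal.ofReal (1 + (A u - 1) * edgeProb α β p s.2.rank σ t u v) else 1 := by
  induction t generalizing v A with
  | zero => simp [isNew, markAt] at hv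
  | succ t ih =>
    set d := (σ t).1 with hd
    let A' : Fin (k + 1) → ℝ := Fin.insertNth (α := fun _ => ℝ) d 1 fun b => A b.castSucc
    have hA' : ∀ u, 0 ≤ A' u := fun u => by
      induction u using d.succAboveCases with
      | x => simp [A']
      | p b => simpa [A'] using hA _
    rw [condMean_succ]
    induction v using Fin.lastCases with
    | last =>
      rw [Fin.prod_univ_castSucc]
      have h1 : ∀ x : State m k, stepMean α β p (σ t) (fun x => ∏ u,
          if isNew σ (t + 1) u ∧ x.2.graph.Adj u (Fin.last k) then
            ENNReal.ofReal (A u) else 1) x =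
          ∫⁻ ξ, (∏ u, if isNew σ t u ∧ u ∈ linked α β x (ξ.1, ξ.2, (σ t).1, (σ t).2) then
            ENNReal.ofReal (A' u) else 1) ∂placement m k p := by
        intro x
        refine lintegral_congr fun ξ => ?_
        beta_reduce
        rw [Fin.prod_univ_castSucc, Fin.prod_univ_succAbove _ d]
        simp [isNew_succ_castSucc, step, newLabels, newGraph_adj_castSucc_last, A', hd]
      rw [condMean_congr fun x _ => h1 x, condMean_prod_linked hm hα hβ s σ t hA',
        Fin.prod_univ_succAbove _ d]
      simp [isNew_succ_castSucc, edgeProb, A', linkRank_succ_castSucc_last, hd,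
        Fin.castSucc_ne_last]
    | cast a =>
      rw [isNew_succ_castSucc] at hv
      have hAl := hA (Fin.last k)
      set P := 1 + (A (Fin.last k) - 1) *
        linkProb α β p (rankAt s.2.rank σ t (d.succAbove a)) with hP
      have h1 : ∀ x, Compatible s σ t x → stepMean α β p (σ t) (fun x => ∏ u,
          if isNew σ (t + 1) u ∧ x.2.graph.Adj u a.castSucc then
            ENNReal.ofReal (A u) else 1) x =
          (∏ u, if isNew σ t u ∧ x.2.graph.Adj u (d.succAbove a) then
            ENNReal.ofReal (A' u) else 1) * ENNReal.ofReal P := by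
        intro x hx
        have h2 : ∀ ξ : Torus m × (Fin (k + 1) → Bool), (∏ u,
          if isNew σ (t + 1) u ∧ (step α β x (ξ.1, ξ.2, (σ t).1, (σ t).2)).2.graph.Adj u
            a.castSucc then ENNReal.ofReal (A u) else 1) =
          (∏ u, if isNew σ t u ∧ x.2.graph.Adj u (d.succAbove a) then
            ENNReal.ofReal (A' u) else 1) *
          if ξ.1 ∈ influenceRegion α β (k + 1)
              ((rankAt s.2.rank σ t (d.succAbove a) : ℕ) + 1) (x.1 (d.succAbove a)) ∧
              ξ.2 (d.succAbove a) = true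
            then ENNReal.ofReal (A (Fin.last k)) else 1 := by
          intro ξ
          rw [Fin.prod_univ_castSucc, Fin.prod_univ_succAbove _ d]
          simp [isNew_succ_castSucc, isNew_succ_last, step, newLabels,
            newGraph_adj_castSucc_castSucc, newGraph_adj_last_castSucc, A', hd, linked,
            rk_of_compatible hx]
        rw [stepMean]
        simp only [h2]
        rw [lintegral_const_mul']
        · congr 1
          rw [placement, lintegral_prod]
          · simp only
            rw [hP, ← lintegral_mem_influenceRegion hm hα hβ _ (x.1 (d.succAbove a)) hAl]
            refine lintegral_congr fun v => ?_
            rw [← lintegral_coin p hAl]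
            exact (measurePreserving_eval (fun _ : Fin (k + 1) => bernoulliMeasure true false p)
              (d.succAbove a)).lintegral_comp (f := fun b => if v ∈ influenceRegion α β (k + 1)
                ((rankAt s.2.rank σ t (d.succAbove a) : ℕ) + 1) (x.1 (d.succAbove a)) ∧ b = true
                then ENNReal.ofReal (A (Fin.last k)) else 1) Measurable.of_discrete
          · refine (Measurable.ite ?_ measurable_const measurable_const).aemeasurable
            refine MeasurableSet.inter ?_ ?_
            · exact measurableSet_le (measurable_fst.dist measurable_const) measurable_const
            · have hc : Measurable fun q : Torus m × (Fin (k + 1) → Bool) =>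
                  q.2 (d.succAbove a) := by fun_prop
              exact hc (measurableSet_singleton true)
        · refine (ENNReal.prod_lt_top fun u _ => ?_).ne
          split_ifs <;> simp
      rw [condMean_congr h1, condMean_mul_const ENNReal.ofReal_ne_top, ih _ hv hA',
        Fin.prod_univ_succAbove _ d, Fin.prod_univ_castSucc]
      simp [isNew_succ_castSucc, isNew_succ_last, edgeProb, A', linkRank_succ_castSucc_castSucc,
        linkRank_succ_last_castSucc, hd, hP, (Fin.castSucc_ne_last _).symm]

end genFun
/-! ### Concentration of the degree, given the choices -/

section chernoff

open scoped ENNReal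

variable {m k : ℕ} {α β : ℝ} {p : unitInterval}

theorem edgeProb_nonneg (ρ : Equiv.Perm (Fin (k + 1))) (σ : ℕ → Choice k) (t : ℕ)
    (u v : Fin (k + 1)) : 0 ≤ edgeProb α β p ρ σ t u v := by
  unfold edgeProb
  split_ifs
  · exact le_rfl
  · exact linkProb_nonneg _

theorem edgeProb_le_one (hα : 0 ≤ α) (hβ : 0 ≤ β) (ρ : Equiv.Perm (Fin (k + 1)))
    (σ : ℕ → Choice k) (t : ℕ) (u v : Fin (k + 1)) : edgeProb α β p ρ σ t u v ≤ 1 := by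
  unfold edgeProb
  split_ifs
  · exact zero_le_one
  · exact linkProb_le_one hα hβ _

open scoped Classical in
theorem State.deg_eq_card (x : State m k) (j : Fin (k + 1)) :
    x.deg j = (Finset.univ.filter fun u => x.2.graph.Adj u j).card := by
  rw [State.deg, ← Set.ncard_coe_finset]
  congr 1
  ext u
  simp [SimpleGraph.adj_comm]

/-- The expected degree of node `j` at time `t`, given the choices. -/
noncomputable def meanDeg (α β : ℝ) (p : unitInterval) (ρ : Equiv.Perm (Fin (k + 1)))
    (σ : ℕ → Choice k) (t : ℕ) (j : Fin (k + 1)) : ℝ :=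
  ∑ u, edgeProb α β p ρ σ t u j

theorem meanDeg_nonneg (ρ : Equiv.Perm (Fin (k + 1))) (σ : ℕ → Choice k) (t : ℕ)
    (j : Fin (k + 1)) : 0 ≤ meanDeg α β p ρ σ t j :=
  Finset.sum_nonneg fun _ _ => edgeProb_nonneg ..

theorem condMean_exp_deg_le (hm : 0 < m) (hα : 0 ≤ α) (hβ : 0 ≤ β) (s : State m k)
    (σ : ℕ → Choice k) (t : ℕ) (hnew : ∀ u, isNew σ t u = true) (j : Fin (k + 1)) (θ : ℝ) :
    condMean α β p s σ t (fun x => ENNReal.ofReal (Real.exp (θ * x.deg j))) ≤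
      ENNReal.ofReal (Real.exp ((Real.exp θ - 1) * meanDeg α β p s.2.rank σ t j)) := by
  classical
  have h1 : ∀ x : State m k, ENNReal.ofReal (Real.exp (θ * x.deg j)) =
      ∏ u, if isNew σ t u ∧ x.2.graph.Adj u j then ENNReal.ofReal (Real.exp θ) else 1 := by
    intro x
    simp only [hnew, true_and]
    rw [Finset.prod_ite, Finset.prod_const, Finset.prod_const_one, mul_one, ← x.deg_eq_card j,
      ← ENNReal.ofReal_pow (Real.exp_nonneg _), ← Real.exp_nat_mul, mul_comm]
  simp only [h1]
  have h2 := condMean_prod_adj (p := p) hm hα hβ s σ t j (hnew j)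
    (A := fun _ => Real.exp θ) fun _ => Real.exp_nonneg _
  have h3 : ∀ u, 0 ≤ 1 + (Real.exp θ - 1) * edgeProb α β p s.2.rank σ t u j := fun u => by
    nlinarith [edgeProb_nonneg (α := α) (β := β) (p := p) s.2.rank σ t u j,
      edgeProb_le_one (p := p) hα hβ s.2.rank σ t u j, Real.exp_nonneg θ]
  refine le_trans (le_of_eq ?_) (b := ∏ u, ENNReal.ofReal
      (1 + (Real.exp θ - 1) * edgeProb α β p s.2.rank σ t u j)) ?_
  · simpa only [hnew, if_true] using h2
  · rw [← ENNReal.ofReal_prod_of_nonneg fun u _ => h3 u, meanDeg, Finset.mul_sum, Real.exp_sum]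
    refine ENNReal.ofReal_le_ofReal (Finset.prod_le_prod (fun u _ => h3 u) fun u _ => ?_)
    rw [add_comm]
    exact Real.add_one_le_exp _

theorem exp_le_one_add_add_sq {x : ℝ} (hx : |x| ≤ 1) : Real.exp x ≤ 1 + x + x ^ 2 := by
  have := abs_le.1 (Real.abs_exp_sub_one_sub_id_le hx)
  linarith [this.2]

theorem measurable_deg (j : Fin (k + 1)) (g : ℕ → ℝ≥0∞) :
    Measurable fun x : State m k => g (x.deg j) :=
  (Measurable.of_discrete (f := fun l : Labels k => g (l.graph.neighborSet j).ncard)).comp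
    measurable_snd

open scoped Classical in
theorem condMean_deg_deviation_le (hm : 0 < m) (hα : 0 ≤ α) (hβ : 0 ≤ β) (s : State m k)
    (σ : ℕ → Choice k) (t : ℕ) (hnew : ∀ u, isNew σ t u = true) (j : Fin (k + 1)) {δ : ℝ}
    (hδ0 : 0 ≤ δ) (hδ1 : δ ≤ 1) :
    condMean α β p s σ t (fun x =>
      if δ * meanDeg α β p s.2.rank σ t j < |(x.deg j : ℝ) - meanDeg α β p s.2.rank σ t j|
        then 1 else 0) ≤
      ENNReal.ofReal (2 * Real.exp (-(δ ^ 2 * meanDeg α β p s.2.rank σ t j / 4))) := by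
  set M := meanDeg α β p s.2.rank σ t j with hM
  have hM0 : 0 ≤ M := meanDeg_nonneg ..
  have hpt : ∀ x : State m k, (if δ * M < |(x.deg j : ℝ) - M| then (1 : ℝ≥0∞) else 0) ≤
      ENNReal.ofReal (Real.exp (δ / 2 * x.deg j)) *
          ENNReal.ofReal (Real.exp (-(δ / 2 * ((1 + δ) * M)))) +
        ENNReal.ofReal (Real.exp (-(δ / 2) * x.deg j)) *
          ENNReal.ofReal (Real.exp (δ / 2 * ((1 - δ) * M))) := by
    intro x
    split_ifs with h
    · rw [← ENNReal.ofReal_mul (Real.exp_nonneg _), ← ENNReal.ofReal_mul (Real.exp_nonneg _),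
        ← Real.exp_add, ← Real.exp_add, ← ENNReal.ofReal_add (Real.exp_nonneg _)
        (Real.exp_nonneg _), ENNReal.one_le_ofReal]
      rcases lt_abs.1 h with h | h
      · have : 1 ≤ Real.exp (δ / 2 * x.deg j + -(δ / 2 * ((1 + δ) * M))) := by
          rw [Real.one_le_exp_iff]
          nlinarith
        linarith [Real.exp_nonneg (-(δ / 2) * x.deg j + δ / 2 * ((1 - δ) * M))]
      · have : 1 ≤ Real.exp (-(δ / 2) * x.deg j + δ / 2 * ((1 - δ) * M)) := by
          rw [Real.one_le_exp_iff]
          nlinarith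
        linarith [Real.exp_nonneg (δ / 2 * x.deg j + -(δ / 2 * ((1 + δ) * M)))]
    · exact zero_le
  refine (condMean_mono fun x _ => hpt x).trans ?_
  rw [condMean_add, condMean_mul_const ENNReal.ofReal_ne_top,
    condMean_mul_const ENNReal.ofReal_ne_top]
  · have e1 := condMean_exp_deg_le (p := p) hm hα hβ s σ t hnew j (δ / 2)
    have e2 := condMean_exp_deg_le (p := p) hm hα hβ s σ t hnew j (-(δ / 2))
    rw [← hM] at e1 e2
    refine (add_le_add (mul_le_mul_left e1 _) (mul_le_mul_left e2 _)).trans ?_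
    rw [← ENNReal.ofReal_mul (Real.exp_nonneg _), ← ENNReal.ofReal_mul (Real.exp_nonneg _),
        ← Real.exp_add, ← Real.exp_add, ← ENNReal.ofReal_add (Real.exp_nonneg _)
        (Real.exp_nonneg _)]
    refine ENNReal.ofReal_le_ofReal ?_
    rw [two_mul]
    have b1 := exp_le_one_add_add_sq (x := δ / 2) (by rw [abs_le]; constructor <;> linarith)
    have b2 := exp_le_one_add_add_sq (x := -(δ / 2)) (by rw [abs_le]; constructor <;> linarith)
    refine add_le_add (Real.exp_le_exp.2 ?_) (Real.exp_le_exp.2 ?_)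
    · nlinarith
    · nlinarith
  · have := measurable_deg (m := m) j fun n => ENNReal.ofReal (Real.exp (δ / 2 * n)) *
      ENNReal.ofReal (Real.exp (-(δ / 2 * ((1 + δ) * M))))
    exact this

end chernoff
/-! ### Concentration for the deletions and the ranks -/

section choices

variable {k : ℕ}

theorem sum_choice_fst (g : Fin (k + 1) → ℝ) :
    (∑ a : Choice k, g a.1) / ((k : ℝ) + 1) ^ 2 = (∑ d, g d) / ((k : ℝ) + 1) := by
  have : (k : ℝ) + 1 ≠ 0 := by positivity
  rw [Fintype.sum_prod_type]
  simp only [Finset.sum_const, Finset.card_univ, Fintype.card_fin, nsmul_eq_mul, ← Finset.mul_sum]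
  push_cast
  field_simp

/-- The number of nodes alive that were born before time `0`. -/
def numOld (σ : ℕ → Choice k) (t : ℕ) : ℝ :=
  ∑ u, if isNew σ t u then 0 else 1

theorem expect_numOld (t : ℕ) :
    expect (k := k) t (fun σ => numOld σ t) = ((k : ℝ) + 1) * (1 - 1 / ((k : ℝ) + 1)) ^ t := by
  have hk : (k : ℝ) + 1 ≠ 0 := by positivity
  induction t with
  | zero => simp [expect, numOld, isNew, markAt]
  | succ t ih =>
    rw [expect_succ, pow_succ (1 - 1 / ((k : ℝ) + 1)), ← mul_assoc, ← ih, mul_comm, ← expect_mul_left]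
    congr 1
    ext σ
    have h1 : ∀ a, numOld (Function.update σ t a) (t + 1) =
        numOld σ t - if isNew σ t a.1 then 0 else 1 := fun a => by
      have h2 := sum_pushMark (fun b : Bool => if b then (0 : ℝ) else 1) (isNew σ t) a.1 true
      have h3 : isNew (Function.update σ t a) (t + 1) = pushMark (isNew σ t) a.1 true := by
        rw [isNew, markAt_succ, Function.update_self]
        congr 1
        exact (adaptedTo_markAt _ _ t).update le_rfl σ a
      simpa [numOld, h3] using h2
    simp only [h1]
    rw [sum_choice_fst fun d => numOld σ t - if isNew σ t d then 0 else 1,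
      Finset.sum_sub_distrib]
    change (_ - numOld σ t) / _ = _
    simp
    field_simp

/-- The marks after `i` steps of the nodes alive at time `τ`, where a node of rank `x + 1` has mark
`w x`, and younger nodes have mark `0`. -/
def survivorMark (w : Fin (k + 1) → ℝ) (ρ : Equiv.Perm (Fin (k + 1))) (σ : ℕ → Choice k)
    (τ i : ℕ) : Fin (k + 1) → ℝ :=
  markAt (fun u => w (rankAt ρ σ τ u)) (fun _ => 0) (fun i => σ (τ + i)) i

theorem adaptedTo_survivorMark (w : Fin (k + 1) → ℝ) (ρ : Equiv.Perm (Fin (k + 1))) (τ i : ℕ) :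
    AdaptedTo (τ + i) fun σ => survivorMark w ρ σ τ i := by
  intro σ σ' h
  have h1 := adaptedTo_rankAt ρ τ σ σ' fun j hj => h j (by omega)
  have h2 := adaptedTo_markAt (fun u => w (rankAt ρ σ τ u)) (fun _ => (0 : ℝ)) i
    (fun i => σ (τ + i)) (fun i => σ' (τ + i)) fun j hj => h _ (by omega)
  simp only [survivorMark] at h1 h2 ⊢
  rw [← h1, h2]

theorem survivorMark_succ (w : Fin (k + 1) → ℝ) (ρ : Equiv.Perm (Fin (k + 1)))
    (σ : ℕ → Choice k) (τ i : ℕ) :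
    survivorMark w ρ σ τ (i + 1) = pushMark (survivorMark w ρ σ τ i) (σ (τ + i)).1 0 := rfl

theorem survivorMark_update (w : Fin (k + 1) → ℝ) (ρ : Equiv.Perm (Fin (k + 1)))
    (σ : ℕ → Choice k) (τ i : ℕ) (a : Choice k) :
    survivorMark w ρ (Function.update σ (τ + i) a) τ (i + 1) =
      pushMark (survivorMark w ρ σ τ i) a.1 0 := by
  rw [survivorMark_succ, Function.update_self]
  congr 1
  exact (adaptedTo_survivorMark w ρ τ i).update le_rfl σ a

theorem abs_survivorMark_le {w : Fin (k + 1) → ℝ} (hw : ∀ x, |w x| ≤ 1)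
    (ρ : Equiv.Perm (Fin (k + 1))) (σ : ℕ → Choice k) (τ i : ℕ) (u : Fin (k + 1)) :
    |survivorMark w ρ σ τ i u| ≤ 1 := by
  induction i generalizing u with
  | zero => exact hw _
  | succ i ih =>
    rw [survivorMark_succ]
    induction u using Fin.lastCases with
    | last => simp
    | cast a => simpa using ih _

theorem sum_sq_survivorMark_le {w : Fin (k + 1) → ℝ} (ρ : Equiv.Perm (Fin (k + 1)))
    (σ : ℕ → Choice k) (τ i : ℕ) :
    ∑ u, survivorMark w ρ σ τ i u ^ 2 ≤ ∑ x, w x ^ 2 := by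
  induction i with
  | zero => exact (Equiv.sum_comp (rankAt ρ σ τ) fun x => w x ^ 2).le
  | succ i ih =>
    rw [survivorMark_succ, sum_pushMark (fun y : ℝ => y ^ 2)]
    have := sq_nonneg (survivorMark w ρ σ τ i (σ (τ + i)).1)
    linarith

theorem expect_exp_survivorMark_le {w : Fin (k + 1) → ℝ} (hw : ∀ x, |w x| ≤ 1)
    (hw0 : ∑ x, w x = 0) (ρ : Equiv.Perm (Fin (k + 1))) (τ i : ℕ) {θ : ℝ} (hθ : |θ| ≤ 1) :
    expect (τ + i) (fun σ => Real.exp (θ * ∑ u, survivorMark w ρ σ τ i u)) ≤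
      Real.exp (θ ^ 2 * ∑ x, w x ^ 2) := by
  have hk : (0 : ℝ) < (k : ℝ) + 1 := by positivity
  set Q := ∑ x, w x ^ 2 with hQ
  have hQ0 : 0 ≤ Q := Finset.sum_nonneg fun _ _ => sq_nonneg _
  induction i generalizing θ with
  | zero =>
    have h1 : ∀ σ : ℕ → Choice k, ∑ u, survivorMark w ρ σ τ 0 u = 0 := fun σ => by
      rw [← hw0]
      exact Equiv.sum_comp (rankAt ρ σ τ) w
    simp only [h1, mul_zero, Real.exp_zero, expect_const]
    exact Real.one_le_exp (by positivity)
  | succ i ih =>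
    set q : ℝ := 1 - 1 / ((k : ℝ) + 1) with hq
    have hinv : 1 / ((k : ℝ) + 1) ≤ 1 := by
      rw [div_le_one hk]; linarith [(Nat.cast_nonneg k : (0 : ℝ) ≤ k)]
    have hinv0 : 0 < 1 / ((k : ℝ) + 1) := by positivity
    have hq0 : 0 ≤ q := by linarith
    have hq1 : q ≤ 1 := by linarith
    have hstep : ∀ σ : ℕ → Choice k,
        (∑ a : Choice k, Real.exp (θ * ∑ u,
          survivorMark w ρ (Function.update σ (τ + i) a) τ (i + 1) u)) / ((k : ℝ) + 1) ^ 2 ≤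
        Real.exp (θ ^ 2 * Q / ((k : ℝ) + 1)) *
          Real.exp (θ * q * ∑ u, survivorMark w ρ σ τ i u) := by
      intro σ
      set f := survivorMark w ρ σ τ i with hf
      set Z := ∑ u, f u with hZ
      have h1 : ∀ a : Choice k,
          ∑ u, survivorMark w ρ (Function.update σ (τ + i) a) τ (i + 1) u = Z - f a.1 :=
        fun a => by
          rw [survivorMark_update, sum_pushMark (fun y : ℝ => y), add_zero]
      simp only [h1]
      rw [sum_choice_fst fun d => Real.exp (θ * (Z - f d))]
      have h2 : ∀ d, Real.exp (θ * (Z - f d)) ≤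
          Real.exp (θ * Z) * (1 - θ * f d + θ ^ 2 * f d ^ 2) := fun d => by
        have h3 : |-(θ * f d)| ≤ 1 := by
          rw [abs_neg, abs_mul]
          exact mul_le_one₀ hθ (abs_nonneg _) (abs_survivorMark_le hw ρ σ τ i d)
        have h4 := exp_le_one_add_add_sq h3
        rw [mul_sub, sub_eq_add_neg, Real.exp_add]
        refine mul_le_mul_of_nonneg_left (h4.trans (le_of_eq ?_)) (Real.exp_nonneg _)
        ring
      have h5 : ∑ d, f d ^ 2 ≤ Q := sum_sq_survivorMark_le ρ σ τ i
      calc (∑ d, Real.exp (θ * (Z - f d))) / ((k : ℝ) + 1)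
          ≤ (∑ d, Real.exp (θ * Z) * (1 - θ * f d + θ ^ 2 * f d ^ 2)) / ((k : ℝ) + 1) := by
            gcongr with d _
            exact h2 d
        _ = Real.exp (θ * Z) * (1 - θ * Z / ((k : ℝ) + 1) +
              θ ^ 2 * (∑ d, f d ^ 2) / ((k : ℝ) + 1)) := by
            rw [← Finset.mul_sum, Finset.sum_add_distrib, Finset.sum_sub_distrib,
              ← Finset.mul_sum, ← Finset.mul_sum, ← hZ]
            simp
            field_simp
        _ ≤ Real.exp (θ * Z) * Real.exp (-(θ * Z / ((k : ℝ) + 1)) +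
              θ ^ 2 * Q / ((k : ℝ) + 1)) := by
            gcongr
            refine le_trans ?_ (Real.add_one_le_exp _)
            have : θ ^ 2 * (∑ d, f d ^ 2) / ((k : ℝ) + 1) ≤ θ ^ 2 * Q / ((k : ℝ) + 1) := by gcongr
            linarith
        _ = _ := by
            rw [← Real.exp_add, ← Real.exp_add]
            congr 1
            rw [hq]
            ring
    have hθq : |θ * q| ≤ 1 := by
      rw [abs_mul, abs_of_nonneg hq0]
      exact mul_le_one₀ hθ hq0 hq1
    rw [← add_assoc, expect_succ]
    refine (expect_mono _ hstep).trans ?_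
    rw [expect_mul_left]
    refine (mul_le_mul_of_nonneg_left (ih hθq) (Real.exp_nonneg _)).trans ?_
    rw [← Real.exp_add, Real.exp_le_exp]
    have h6 : 1 / ((k : ℝ) + 1) + q ^ 2 ≤ 1 := by nlinarith
    calc _ = (θ ^ 2 * Q) * (1 / ((k : ℝ) + 1) + q ^ 2) := by ring
      _ ≤ (θ ^ 2 * Q) * 1 := by gcongr
      _ = _ := mul_one _

/-! ### Ranks stay close to initial ranks -/

theorem sum_ite_le (x : Fin (k + 1)) :
    ∑ R : Fin (k + 1), (if (R : ℕ) ≤ (x : ℕ) then (1 : ℝ) else 0) = (x : ℝ) + 1 := by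
  rw [Finset.sum_ite, Finset.sum_const_zero, add_zero, Finset.sum_const]
  have : (Finset.univ.filter fun R : Fin (k + 1) => (R : ℕ) ≤ (x : ℕ)) = Finset.Iic x := by
    ext; simp
  rw [this, Fin.card_Iic, nsmul_eq_mul, mul_one]
  push_cast
  rfl

theorem sum_ite_lt (x : Fin (k + 1)) :
    ∑ e : Fin (k + 1), (if e < x then (1 : ℝ) else 0) = (x : ℝ) := by
  rw [Finset.sum_ite, Finset.sum_const_zero, add_zero, Finset.sum_const]
  have : (Finset.univ.filter fun e : Fin (k + 1) => e < x) = Finset.Iio x := by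
    ext; simp
  rw [this, Fin.card_Iio, nsmul_eq_mul, mul_one]

/-- The change of a rank in one step is almost centered, with variance of the order of `rank / n`. -/
theorem sum_exp_rank_change_le (x : Fin (k + 1)) {θ : ℝ} (hθ : |θ| ≤ 1) :
    ∑ e : Fin (k + 1), ∑ R : Fin (k + 1), Real.exp (θ *
      ((if ((R : ℕ) : ℤ) ≤ ((x : ℕ) : ℤ) - (if e < x then 1 else 0) then (1 : ℝ) else 0) -
        if e < x then (1 : ℝ) else 0)) ≤
      ((k : ℝ) + 1) ^ 2 *
        Real.exp (|θ| / ((k : ℝ) + 1) + 2 * θ ^ 2 / ((k : ℝ) + 1) * ((x : ℝ) + 1)) := by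
  have hk : (0 : ℝ) < (k : ℝ) + 1 := by positivity
  set γ : Fin (k + 1) → ℝ := fun e => if e < x then 1 else 0 with hγ
  set δ : Fin (k + 1) → Fin (k + 1) → ℝ := fun e R =>
    if ((R : ℕ) : ℤ) ≤ ((x : ℕ) : ℤ) - (if e < x then 1 else 0) then (1 : ℝ) else 0 with hδ
  have h1 : ∀ e R, Real.exp (θ * (δ e R - γ e)) ≤
      1 + θ * (δ e R - γ e) + θ ^ 2 * (δ e R + γ e) := by
    intro e R
    have hδ' : δ e R = 0 ∨ δ e R = 1 := by simp only [hδ]; split_ifs <;> simp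
    have hγ' : γ e = 0 ∨ γ e = 1 := by simp only [hγ]; split_ifs <;> simp
    have h2 : |δ e R - γ e| ≤ 1 := by
      rcases hδ' with h | h <;> rcases hγ' with h' | h' <;> simp [h, h']
    have h3 := exp_le_one_add_add_sq (x := θ * (δ e R - γ e)) (by
      rw [abs_mul]; exact mul_le_one₀ hθ (abs_nonneg _) h2)
    have h4 : (δ e R - γ e) ^ 2 ≤ δ e R + γ e := by
      rcases hδ' with h | h <;> rcases hγ' with h' | h' <;> norm_num [h, h']
    rw [mul_pow] at h3
    nlinarith [mul_le_mul_of_nonneg_left h4 (sq_nonneg θ)]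
  have hsδ : ∀ e, ∑ R, δ e R = (x : ℝ) + 1 - γ e := by
    intro e
    by_cases he : e < x
    · have hx : (x : ℕ) - 1 < k + 1 := by omega
      have hx1 : 1 ≤ (x : ℕ) := by have := Fin.lt_def.1 he; omega
      have := sum_ite_le (⟨(x : ℕ) - 1, hx⟩ : Fin (k + 1))
      simp only [hδ, hγ, he, if_true]
      simp only at this
      rw [Nat.cast_sub hx1] at this
      push_cast at this
      rw [← this.trans (by ring : (x : ℝ) - 1 + 1 = (x : ℝ) + 1 - 1)]
      refine Finset.sum_congr rfl fun R _ => ?_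
      congr 1
      rw [eq_iff_iff]
      omega
    · have := sum_ite_le x
      simp only [hδ, hγ, he, if_false, sub_zero]
      rw [← this]
      refine Finset.sum_congr rfl fun R _ => ?_
      congr 1
      rw [eq_iff_iff]
      omega
  have hsγ : ∑ e, γ e = (x : ℝ) := sum_ite_lt x
  have hx0 : (0 : ℝ) ≤ (x : ℝ) := Nat.cast_nonneg _
  have hxk : (x : ℝ) ≤ k := by exact_mod_cast Nat.lt_succ_iff.1 x.2
  have hsum : ∑ e, ∑ R, (1 + θ * (δ e R - γ e) + θ ^ 2 * (δ e R + γ e)) =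
      ((k : ℝ) + 1) ^ 2 + θ * (((k : ℝ) + 1) - x) +
        θ ^ 2 * (((k : ℝ) + 1) * (2 * x + 1) - x) := by
    have h5 : ∀ e, ∑ R, (1 + θ * (δ e R - γ e) + θ ^ 2 * (δ e R + γ e)) =
        ((k : ℝ) + 1) + θ * ((x : ℝ) + 1) + θ ^ 2 * ((x : ℝ) + 1) +
          (θ ^ 2 * k - θ * (k + 2)) * γ e := by
      intro e
      simp only [Finset.sum_add_distrib, ← Finset.mul_sum, Finset.sum_sub_distrib, hsδ]
      simp
      ring
    simp only [h5, Finset.sum_add_distrib, ← Finset.mul_sum, hsγ]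
    simp
    ring
  calc _ ≤ ∑ e, ∑ R, (1 + θ * (δ e R - γ e) + θ ^ 2 * (δ e R + γ e)) :=
        Finset.sum_le_sum fun e _ => Finset.sum_le_sum fun R _ => h1 e R
    _ ≤ ((k : ℝ) + 1) ^ 2 *
        (1 + (|θ| / ((k : ℝ) + 1) + 2 * θ ^ 2 / ((k : ℝ) + 1) * ((x : ℝ) + 1))) := by
      rw [hsum]
      have e1 : ((k : ℝ) + 1) ^ 2 *
        (1 + (|θ| / ((k : ℝ) + 1) + 2 * θ ^ 2 / ((k : ℝ) + 1) * ((x : ℝ) + 1))) =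
        ((k : ℝ) + 1) ^ 2 + |θ| * ((k : ℝ) + 1) + θ ^ 2 * (2 * ((k : ℝ) + 1) * (x + 1)) := by
        field_simp
        ring
      rw [e1]
      have e2 : θ * (((k : ℝ) + 1) - x) ≤ |θ| * ((k : ℝ) + 1) := by
        calc θ * (((k : ℝ) + 1) - x) ≤ |θ| * (((k : ℝ) + 1) - x) := by
              gcongr
              · linarith
              · exact le_abs_self θ
          _ ≤ _ := by gcongr; linarith
      have e3 : θ ^ 2 * (((k : ℝ) + 1) * (2 * x + 1) - x) ≤
          θ ^ 2 * (2 * ((k : ℝ) + 1) * (x + 1)) := by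
        gcongr
        nlinarith
      linarith
    _ ≤ _ := by
      gcongr
      rw [add_comm]
      exact Real.add_one_le_exp _

/-- The initial ranks of the nodes alive at time `t`. -/
def birthRank (ρ : Equiv.Perm (Fin (k + 1))) (σ : ℕ → Choice k) (t : ℕ) :
    Fin (k + 1) → Fin (k + 1) :=
  markAt ρ Prod.snd σ t

/-- The exponential moments that compare ranks with initial ranks. -/
noncomputable def rankMoment (ρ : Equiv.Perm (Fin (k + 1))) (θ κ : ℝ) (t : ℕ)
    (σ : ℕ → Choice k) : ℝ :=
  ∑ u, Real.exp (θ * ((rankAt ρ σ t u : ℕ) + 1) - κ * ((birthRank ρ σ t u : ℕ) + 1))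

theorem sum_succAbove_comm (F : Fin (k + 1) → Fin (k + 1) → ℝ) (hF : ∀ d, 0 ≤ F d d) :
    ∑ d, ∑ b : Fin k, F d (d.succAbove b) ≤ ∑ u, ∑ d, F d u := by
  refine le_of_le_of_eq (Finset.sum_le_sum fun d _ => ?_) Finset.sum_comm
  rw [Fin.sum_univ_succAbove (F d) d]
  linarith [hF d]

theorem rankMoment_step_le (ρ : Equiv.Perm (Fin (k + 1))) {θ κ : ℝ} (hθ : |θ| ≤ 1) (hκ : θ ≤ κ)
    (t : ℕ) (σ : ℕ → Choice k) :
    (∑ a : Choice k, rankMoment ρ θ κ (t + 1) (Function.update σ t a)) / ((k : ℝ) + 1) ^ 2 ≤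
      Real.exp (|θ| / ((k : ℝ) + 1)) *
        rankMoment ρ (θ + 2 * θ ^ 2 / ((k : ℝ) + 1)) κ t σ + 1 := by
  have hk : (0 : ℝ) < (k : ℝ) + 1 := by positivity
  set r := rankAt ρ σ t with hr
  set I := birthRank ρ σ t with hI
  have hr1 : ∀ a, rankAt ρ (Function.update σ t a) (t + 1) = newRank r a.1 a.2 := fun a => by
    rw [rankAt_succ, Function.update_self]
    congr 1
    exact (adaptedTo_rankAt ρ t).update le_rfl σ a
  have hI1 : ∀ a, birthRank ρ (Function.update σ t a) (t + 1) = pushMark I a.1 a.2 :=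
    fun a => by
      rw [birthRank, markAt_succ, Function.update_self]
      congr 1
      exact (adaptedTo_markAt _ _ t).update le_rfl σ a
  let G : Fin (k + 1) → Fin (k + 1) → Fin (k + 1) → ℝ := fun R d u =>
    Real.exp (θ * ((r u : ℕ) + 1) - κ * ((I u : ℕ) + 1)) * Real.exp (θ *
      ((if ((R : ℕ) : ℤ) ≤ ((r u : ℕ) : ℤ) - (if r d < r u then 1 else 0) then (1 : ℝ) else 0) -
        if r d < r u then (1 : ℝ) else 0))
  have h1 : ∀ a : Choice k, rankMoment ρ θ κ (t + 1) (Function.update σ t a) ≤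
      ∑ b : Fin k, G a.2 a.1 (a.1.succAbove b) + 1 := by
    intro a
    rw [rankMoment, Fin.sum_univ_castSucc, hr1, hI1]
    refine add_le_add (Finset.sum_le_sum fun b _ => le_of_eq ?_) ?_
    · have h2 := newRank_survivor r a.1 a.2 b
      have h3 : ((newRank r a.1 a.2 b.castSucc : ℕ) : ℝ) = _ :=
        (Int.cast_natCast _).symm.trans (congrArg (Int.cast : ℤ → ℝ) h2)
      simp only at h3
      push_cast at h3
      simp only [G]
      rw [← Real.exp_add, h3, pushMark_castSucc]
      congr 1
      ring
    · rw [newRank_last, pushMark_last, ← sub_mul]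
      rw [Real.exp_le_one_iff]
      exact mul_nonpos_of_nonpos_of_nonneg (by linarith) (by positivity)
  have h4 : ∀ u, ∑ R, ∑ d, G R d u ≤
      Real.exp (θ * ((r u : ℕ) + 1) - κ * ((I u : ℕ) + 1)) * (((k : ℝ) + 1) ^ 2 *
        Real.exp (|θ| / ((k : ℝ) + 1) + 2 * θ ^ 2 / ((k : ℝ) + 1) * ((r u : ℝ) + 1))) := by
    intro u
    simp only [G, ← Finset.mul_sum]
    refine mul_le_mul_of_nonneg_left ?_ (Real.exp_nonneg _)
    refine le_trans (le_of_eq ?_) (sum_exp_rank_change_le (r u) hθ)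
    rw [Finset.sum_comm]
    exact Equiv.sum_comp r fun e => ∑ R : Fin (k + 1), Real.exp (θ *
      ((if ((R : ℕ) : ℤ) ≤ ((r u : ℕ) : ℤ) - (if e < r u then 1 else 0) then (1 : ℝ) else 0) -
        if e < r u then (1 : ℝ) else 0))
  have h5 : ∑ a : Choice k, ∑ b : Fin k, G a.2 a.1 (a.1.succAbove b) ≤
      ((k : ℝ) + 1) ^ 2 * (Real.exp (|θ| / ((k : ℝ) + 1)) *
        rankMoment ρ (θ + 2 * θ ^ 2 / ((k : ℝ) + 1)) κ t σ) := by
    rw [Fintype.sum_prod_type, Finset.sum_comm]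
    calc _ ≤ ∑ R, ∑ u, ∑ d, G R d u := by
          refine Finset.sum_le_sum fun R _ => sum_succAbove_comm (G R) fun d => ?_
          positivity
      _ = ∑ u, ∑ R, ∑ d, G R d u := Finset.sum_comm
      _ ≤ _ := Finset.sum_le_sum fun u _ => h4 u
      _ = _ := by
        rw [rankMoment, Finset.mul_sum, Finset.mul_sum]
        refine Finset.sum_congr rfl fun u _ => ?_
        rw [mul_left_comm, ← Real.exp_add, ← Real.exp_add]
        congr 2
        ring
  calc _ ≤ (∑ a : Choice k, (∑ b : Fin k, G a.2 a.1 (a.1.succAbove b) + 1)) /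
        ((k : ℝ) + 1) ^ 2 := by
        gcongr with a _
        exact h1 a
    _ ≤ _ := by
        rw [Finset.sum_add_distrib, add_div, sum_choice_const]
        gcongr
        rw [div_le_iff₀ (by positivity), mul_comm]
        exact h5

/-- The parameters of the exponential moments, followed backwards in time. -/
noncomputable def tilt (n θ : ℝ) : ℕ → ℝ
  | 0 => θ
  | i + 1 => tilt n (θ + 2 * θ ^ 2 / n) i

theorem expect_rankMoment_le (ρ : Equiv.Perm (Fin (k + 1))) {θ κ Θ : ℝ} (hΘ : Θ ≤ 1) (t : ℕ)
    (h1 : ∀ i ≤ t, |tilt (k + 1) θ i| ≤ Θ) (h2 : ∀ i ≤ t, tilt (k + 1) θ i ≤ κ) :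
    expect t (rankMoment ρ θ κ t) ≤
      ((k : ℝ) + 1 + t) * Real.exp (t * (Θ / ((k : ℝ) + 1))) := by
  have hk : (0 : ℝ) < (k : ℝ) + 1 := by positivity
  have hΘ0 : 0 ≤ Θ := (abs_nonneg _).trans (h1 0 (Nat.zero_le _))
  induction t generalizing θ with
  | zero =>
    simp only [expect, rankMoment, rankAt, birthRank, markAt, ← sub_mul]
    have h3 : θ ≤ κ := h2 0 le_rfl
    calc _ ≤ ∑ _u : Fin (k + 1), (1 : ℝ) := by
          refine Finset.sum_le_sum fun u _ => ?_
          rw [Real.exp_le_one_iff]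
          exact mul_nonpos_of_nonpos_of_nonneg (by linarith) (by positivity)
      _ = _ := by simp
  | succ t ih =>
    have h3 : |θ| ≤ Θ := h1 0 (Nat.zero_le _)
    have h4 := ih (θ := θ + 2 * θ ^ 2 / (k + 1)) (fun i hi => h1 (i + 1) (by omega))
      (fun i hi => h2 (i + 1) (by omega))
    rw [expect_succ]
    refine (expect_mono t (rankMoment_step_le ρ (h3.trans hΘ) (h2 0 (Nat.zero_le _)) t)).trans ?_
    rw [expect_add, expect_mul_left, expect_const]
    have h5 : Real.exp (|θ| / ((k : ℝ) + 1)) ≤ Real.exp (Θ / ((k : ℝ) + 1)) := by gcongr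
    have h6 : 1 ≤ Real.exp (((t + 1 : ℕ) : ℝ) * (Θ / ((k : ℝ) + 1))) :=
      Real.one_le_exp (by positivity)
    calc _ ≤ Real.exp (Θ / ((k : ℝ) + 1)) *
          (((k : ℝ) + 1 + t) * Real.exp (t * (Θ / ((k : ℝ) + 1)))) +
            Real.exp (((t + 1 : ℕ) : ℝ) * (Θ / ((k : ℝ) + 1))) :=
          add_le_add (mul_le_mul h5 h4 (by
            refine le_trans (le_of_eq (expect_const t 0).symm) (expect_mono t fun σ => ?_)
            exact Finset.sum_nonneg fun _ _ => Real.exp_nonneg _) (Real.exp_nonneg _)) h6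
      _ = _ := by
          push_cast
          rw [add_mul (t : ℝ), Real.exp_add]
          ring_nf

theorem tilt_succ (n θ : ℝ) (i : ℕ) :
    tilt n θ (i + 1) = tilt n θ i + 2 * tilt n θ i ^ 2 / n := by
  induction i generalizing θ with
  | zero => rfl
  | succ i ih => rw [tilt, ih]; rfl

theorem tilt_mem {n θ : ℝ} (hn : 0 < n) {T : ℕ} (hT : 8 * |θ| * T ≤ n) (i : ℕ) (hi : i ≤ T) :
    |tilt n θ i| ≤ 2 * |θ| ∧ tilt n θ i ≤ θ + 8 * θ ^ 2 * i / n := by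
  have hb : ∀ i ≤ T, 8 * θ ^ 2 * i / n ≤ |θ| := fun i hi => by
    rw [div_le_iff₀ hn, ← sq_abs]
    have : (i : ℝ) ≤ T := by exact_mod_cast hi
    calc 8 * |θ| ^ 2 * i ≤ 8 * |θ| ^ 2 * T := by gcongr
      _ = |θ| * (8 * |θ| * T) := by ring
      _ ≤ |θ| * n := by gcongr
  have hab : ∀ i ≤ T, ∀ y, θ ≤ y → y ≤ θ + 8 * θ ^ 2 * i / n → |y| ≤ 2 * |θ| :=
    fun i hi y h1 h2 => by
      rw [abs_le]
      constructor <;> linarith [neg_abs_le θ, le_abs_self θ, abs_nonneg θ, hb i hi]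
  have key : ∀ i ≤ T, θ ≤ tilt n θ i ∧ tilt n θ i ≤ θ + 8 * θ ^ 2 * i / n := by
    intro i hi
    induction i with
    | zero => simp [tilt]
    | succ i ih =>
      obtain ⟨h1, h2⟩ := ih (by omega)
      have h3 : |tilt n θ i| ≤ 2 * |θ| := hab i (by omega) _ h1 h2
      have h4 : tilt n θ i ^ 2 ≤ 4 * θ ^ 2 := by
        rw [← sq_abs, ← sq_abs θ]
        nlinarith [abs_nonneg (tilt n θ i), abs_nonneg θ]
      rw [tilt_succ]
      constructor
      · have : 0 ≤ 2 * tilt n θ i ^ 2 / n := by positivity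
        linarith
      · have : 2 * tilt n θ i ^ 2 / n ≤ 2 * (4 * θ ^ 2) / n := by gcongr
        have e : 8 * θ ^ 2 * ((i + 1 : ℕ) : ℝ) / n =
            8 * θ ^ 2 * i / n + 2 * (4 * θ ^ 2) / n := by
          push_cast
          ring
        linarith
  exact ⟨hab i hi _ (key i hi).1 (key i hi).2, (key i hi).2⟩

end choices
/-! ### The links of a node -/

section links

variable {k : ℕ}

theorem isNew_eq_false_zero (σ : ℕ → Choice k) (u : Fin (k + 1)) : isNew σ 0 u = false := rfl

theorem birthRank_succ_castSucc (ρ : Equiv.Perm (Fin (k + 1))) (σ : ℕ → Choice k) (t : ℕ)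
    (a : Fin k) :
    birthRank ρ σ (t + 1) a.castSucc = birthRank ρ σ t ((σ t).1.succAbove a) := by
  simp [birthRank, markAt_succ]

/-- The rank that governs a link to a younger node is one of the ranks in the life of the node. -/
theorem exists_linkRank_of_lt (ρ : Equiv.Perm (Fin (k + 1))) (σ : ℕ → Choice k) (t : ℕ)
    {u j : Fin (k + 1)} (hu : isNew σ t u = true) (hj : j < u) :
    ∃ i < t, ∃ a, linkRank ρ σ t u j = rankAt ρ σ i a ∧ birthRank ρ σ t j = birthRank ρ σ i a := by
  induction t generalizing u j with
  | zero => simp [isNew_eq_false_zero] at hu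
  | succ t ih =>
    induction j using Fin.lastCases with
    | last => exact absurd hj (Fin.le_last u).not_gt
    | cast b =>
      induction u using Fin.lastCases with
      | last =>
        exact ⟨t, Nat.lt_succ_self t, _, linkRank_succ_last_castSucc ρ σ t b,
          birthRank_succ_castSucc ρ σ t b⟩
      | cast a =>
        rw [isNew_succ_castSucc] at hu
        obtain ⟨i, hi, c, h1, h2⟩ := ih hu
          ((Fin.strictMono_succAbove (σ t).1) (Fin.castSucc_lt_castSucc_iff.1 hj))
        exact ⟨i, hi.trans (Nat.lt_succ_self t), c,
          (linkRank_succ_castSucc_castSucc ρ σ t a b).trans h1,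
          (birthRank_succ_castSucc ρ σ t b).trans h2⟩

/-- The ranks that govern the links to older nodes are those at the birth of the node. -/
theorem exists_survivorMark_eq (ρ : Equiv.Perm (Fin (k + 1))) (σ : ℕ → Choice k) (t : ℕ)
    {j : Fin (k + 1)} (hj : isNew σ t j = true) :
    ∃ τ i, τ + i = t ∧ ∀ w u,
      survivorMark w ρ σ τ i u = if u < j then w (linkRank ρ σ t u j) else 0 := by
  induction t generalizing j with
  | zero => simp [isNew_eq_false_zero] at hj
  | succ t ih =>
    induction j using Fin.lastCases with
    | last =>
      refine ⟨t, 1, rfl, fun w u => ?_⟩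
      rw [survivorMark_succ]
      induction u using Fin.lastCases with
      | last => simp
      | cast a =>
        simp [Fin.castSucc_lt_last, linkRank_succ_castSucc_last, survivorMark, markAt]
    | cast b =>
      rw [isNew_succ_castSucc] at hj
      obtain ⟨τ, i, rfl, h⟩ := ih hj
      refine ⟨τ, i + 1, rfl, fun w u => ?_⟩
      rw [survivorMark_succ]
      induction u using Fin.lastCases with
      | last => simp [(Fin.castSucc_lt_last b).not_gt]
      | cast a =>
        simp [h, linkRank_succ_castSucc_castSucc]

theorem meanDeg_eq {α β : ℝ} {p : unitInterval} (ρ : Equiv.Perm (Fin (k + 1)))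
    (σ : ℕ → Choice k) (t : ℕ) (j : Fin (k + 1)) :
    meanDeg α β p ρ σ t j =
      ∑ u, (if u < j then linkProb α β p (linkRank ρ σ t u j) else 0) +
        ∑ u ∈ Finset.Ioi j, linkProb α β p (linkRank ρ σ t u j) := by
  have h : ∑ u ∈ Finset.Ioi j, linkProb α β p (linkRank ρ σ t u j) =
      ∑ u, if j < u then linkProb α β p (linkRank ρ σ t u j) else 0 := by
    rw [← Finset.sum_filter]
    congr 1
    ext; simp
  rw [h, ← Finset.sum_add_distrib, meanDeg]
  refine Finset.sum_congr rfl fun u _ => ?_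
  rcases lt_trichotomy u j with h | h | h
  · simp [edgeProb, h, h.ne, h.not_gt]
  · simp [edgeProb, h]
  · simp [edgeProb, h, h.ne', h.not_gt]

end links

section deviations

variable {k : ℕ}

open scoped Classical in
theorem expect_exists_old_le (L : ℕ) :
    expect (k := k) L (fun σ => if ∃ u, isNew σ L u = false then 1 else 0) ≤
      ((k : ℝ) + 1) * Real.exp (-((L : ℝ) / ((k : ℝ) + 1))) := by
  have hk : (0 : ℝ) < (k : ℝ) + 1 := by positivity
  refine (expect_mono L (G := fun σ => numOld σ L) fun σ => ?_).trans ?_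
  · split_ifs with h
    · obtain ⟨u, hu⟩ := h
      refine le_trans (b := if isNew σ L u then (0 : ℝ) else 1) (by simp [hu]) ?_
      exact Finset.single_le_sum (f := fun u => if isNew σ L u then (0 : ℝ) else 1)
        (fun v _ => by split_ifs <;> simp) (Finset.mem_univ u)
    · exact Finset.sum_nonneg fun v _ => by split_ifs <;> simp
  · rw [expect_numOld]
    gcongr
    have h1 : 1 - 1 / ((k : ℝ) + 1) ≤ Real.exp (-(1 / ((k : ℝ) + 1))) := by
      have := Real.add_one_le_exp (-(1 / ((k : ℝ) + 1)))
      linarith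
    have h2 : 0 ≤ 1 - 1 / ((k : ℝ) + 1) := by
      rw [sub_nonneg, div_le_one hk]
      linarith [(Nat.cast_nonneg k : (0 : ℝ) ≤ k)]
    refine (pow_le_pow_left₀ h2 h1 L).trans (le_of_eq ?_)
    rw [← Real.exp_nat_mul]
    congr 1
    ring

open scoped Classical in
theorem expect_survivorMark_deviation_le {w : Fin (k + 1) → ℝ} (hw : ∀ x, |w x| ≤ 1)
    (hw0 : ∑ x, w x = 0) (ρ : Equiv.Perm (Fin (k + 1))) (τ i : ℕ) {θ y : ℝ} (hθ0 : 0 ≤ θ)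
    (hθ : θ ≤ 1) :
    expect (τ + i) (fun σ => if y < |∑ u, survivorMark w ρ σ τ i u| then 1 else 0) ≤
      2 * Real.exp (-(θ * y) + θ ^ 2 * ∑ x, w x ^ 2) := by
  have hθ1 : |θ| ≤ 1 := by rwa [abs_of_nonneg hθ0]
  have hθ2 : |-θ| ≤ 1 := by rwa [abs_neg]
  have h1 : ∀ σ : ℕ → Choice k,
      (if y < |∑ u, survivorMark w ρ σ τ i u| then (1 : ℝ) else 0) ≤
        Real.exp (-(θ * y)) * (Real.exp (θ * ∑ u, survivorMark w ρ σ τ i u) +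
          Real.exp (-θ * ∑ u, survivorMark w ρ σ τ i u)) := by
    intro σ
    set Z := ∑ u, survivorMark w ρ σ τ i u
    rw [mul_add, ← Real.exp_add, ← Real.exp_add]
    split_ifs with h
    · rcases lt_abs.1 h with h | h
      · have : 1 ≤ Real.exp (-(θ * y) + θ * Z) := by
          rw [Real.one_le_exp_iff]
          nlinarith
        linarith [Real.exp_nonneg (-(θ * y) + -θ * Z)]
      · have : 1 ≤ Real.exp (-(θ * y) + -θ * Z) := by
          rw [Real.one_le_exp_iff]
          nlinarith
        linarith [Real.exp_nonneg (-(θ * y) + θ * Z)]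
    · positivity
  refine (expect_mono _ h1).trans ?_
  rw [expect_mul_left, expect_add, Real.exp_add]
  have e1 := expect_exp_survivorMark_le hw hw0 ρ τ i hθ1
  have e2 := expect_exp_survivorMark_le hw hw0 ρ τ i hθ2
  rw [neg_sq] at e2
  nlinarith [Real.exp_nonneg (-(θ * y))]

/-- The rank of some node at time `t` is far from its initial rank. -/
def RankDeviates (ρ : Equiv.Perm (Fin (k + 1))) (δ M : ℝ) (t : ℕ) (σ : ℕ → Choice k) : Prop :=
  ∃ u, δ * max ((birthRank ρ σ t u : ℝ) + 1) M <
    |((rankAt ρ σ t u : ℝ) + 1) - ((birthRank ρ σ t u : ℝ) + 1)|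

theorem exp_le_rankMoment (ρ : Equiv.Perm (Fin (k + 1))) (σ : ℕ → Choice k) (t : ℕ)
    (u : Fin (k + 1)) {θ δ M ε : ℝ} (hε : ε ≤ |θ| * δ / 2) (hθδ : 0 ≤ |θ| * δ)
    (h : |θ| * (δ * max ((birthRank ρ σ t u : ℝ) + 1) M) <
      θ * (((rankAt ρ σ t u : ℝ) + 1) - ((birthRank ρ σ t u : ℝ) + 1))) :
    1 ≤ Real.exp (-(|θ| * δ * M / 2)) * rankMoment ρ θ (θ + ε) t σ := by
  set r : ℝ := (rankAt ρ σ t u : ℝ) + 1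
  set b : ℝ := (birthRank ρ σ t u : ℝ) + 1
  have hb0 : 0 ≤ b := by positivity
  have h1 : Real.exp (θ * r - (θ + ε) * b) ≤ rankMoment ρ θ (θ + ε) t σ :=
    Finset.single_le_sum (f := fun u => Real.exp (θ * ((rankAt ρ σ t u : ℕ) + 1) -
      (θ + ε) * ((birthRank ρ σ t u : ℕ) + 1))) (fun v _ => Real.exp_nonneg _) (Finset.mem_univ u)
  refine le_trans ?_ (mul_le_mul_of_nonneg_left h1 (Real.exp_nonneg _))
  rw [← Real.exp_add, Real.one_le_exp_iff]
  have h2 : ε * b ≤ |θ| * δ / 2 * b := mul_le_mul_of_nonneg_right hε hb0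
  have h3 := mul_le_mul_of_nonneg_left (le_max_left b M) hθδ
  have h4 := mul_le_mul_of_nonneg_left (le_max_right b M) hθδ
  nlinarith

open scoped Classical in
theorem expect_rankDeviates_le (ρ : Equiv.Perm (Fin (k + 1))) {δ M θ : ℝ} {T : ℕ}
    (hδ0 : 0 ≤ δ) (hδ1 : δ ≤ 1) (h0 : 0 < θ) (hθ1 : 2 * θ ≤ 1)
    (hθ : 16 * θ * T ≤ δ * ((k : ℝ) + 1)) {t : ℕ} (ht : t ≤ T) :
    expect t (fun σ => if RankDeviates ρ δ M t σ then 1 else 0) ≤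
      6 * (((k : ℝ) + 1) + T) * Real.exp (-(θ * δ * M / 2)) := by
  have hk : (0 : ℝ) < (k : ℝ) + 1 := by positivity
  have hθ0 := h0.le
  have htT : (t : ℝ) ≤ T := by exact_mod_cast ht
  have hT' : 8 * |θ| * T ≤ (k : ℝ) + 1 := by
    rw [abs_of_nonneg hθ0]
    nlinarith [(by positivity : 0 ≤ 8 * θ * T), mul_le_mul_of_nonneg_right hδ1 hk.le]
  have hε : 8 * θ ^ 2 * T / ((k : ℝ) + 1) ≤ θ * δ / 2 := by
    rw [div_le_iff₀ hk]
    nlinarith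
  have hmom : ∀ θ', |θ'| = θ →
      expect t (rankMoment ρ θ' (θ' + 8 * θ ^ 2 * T / ((k : ℝ) + 1)) t) ≤
        ((k : ℝ) + 1 + T) * 3 := by
    intro θ' hθ'
    have h8 : 8 * |θ'| * T ≤ (k : ℝ) + 1 := by rw [hθ', ← abs_of_nonneg hθ0]; exact hT'
    have hsq : θ' ^ 2 = θ ^ 2 := by rw [← sq_abs, hθ']
    refine (expect_rankMoment_le ρ hθ1 t (fun i hi => ?_) fun i hi => ?_).trans ?_
    · rw [← hθ']
      exact (tilt_mem hk h8 i (hi.trans ht)).1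
    · refine (tilt_mem hk h8 i (hi.trans ht)).2.trans ?_
      rw [hsq]
      have : (i : ℝ) ≤ T := by exact_mod_cast hi.trans ht
      gcongr
    · have : (t : ℝ) * (2 * θ / ((k : ℝ) + 1)) ≤ 1 := by
        rw [← mul_div_assoc, div_le_one hk]
        nlinarith [mul_le_mul_of_nonneg_right htT hθ0, mul_le_mul_of_nonneg_right hδ1 hk.le]
      have h3 : Real.exp (t * (2 * θ / ((k : ℝ) + 1))) ≤ 3 :=
        (Real.exp_le_exp.2 this).trans Real.exp_one_lt_three.le
      gcongr
  have hpt : ∀ σ, (if RankDeviates ρ δ M t σ then (1 : ℝ) else 0) ≤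
      Real.exp (-(θ * δ * M / 2)) *
        (rankMoment ρ θ (θ + 8 * θ ^ 2 * T / ((k : ℝ) + 1)) t σ +
          rankMoment ρ (-θ) (-θ + 8 * θ ^ 2 * T / ((k : ℝ) + 1)) t σ) := by
    intro σ
    have hpos : ∀ a b, 0 ≤ rankMoment ρ a b t σ := fun a b =>
      Finset.sum_nonneg fun _ _ => Real.exp_nonneg _
    rw [mul_add]
    split_ifs with h
    · obtain ⟨u, hu⟩ := h
      rcases lt_abs.1 hu with hu | hu
      · have := exp_le_rankMoment ρ σ t u (θ := θ) (δ := δ) (M := M)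
          (ε := 8 * θ ^ 2 * T / ((k : ℝ) + 1)) (by rwa [abs_of_nonneg hθ0]) (by positivity)
          (by rw [abs_of_nonneg hθ0]; exact mul_lt_mul_of_pos_left hu h0)
        rw [abs_of_nonneg hθ0] at this
        linarith [mul_nonneg (Real.exp_nonneg (-(θ * δ * M / 2)))
          (hpos (-θ) (-θ + 8 * θ ^ 2 * T / ((k : ℝ) + 1)))]
      · have := exp_le_rankMoment ρ σ t u (θ := -θ) (δ := δ) (M := M)
          (ε := 8 * θ ^ 2 * T / ((k : ℝ) + 1)) (by rwa [abs_neg, abs_of_nonneg hθ0])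
          (by positivity) (by
            rw [abs_neg, abs_of_nonneg hθ0, neg_mul, ← mul_neg]
            exact mul_lt_mul_of_pos_left hu h0)
        rw [abs_neg, abs_of_nonneg hθ0] at this
        linarith [mul_nonneg (Real.exp_nonneg (-(θ * δ * M / 2)))
          (hpos θ (θ + 8 * θ ^ 2 * T / ((k : ℝ) + 1)))]
    · exact add_nonneg (mul_nonneg (Real.exp_nonneg _) (hpos _ _))
        (mul_nonneg (Real.exp_nonneg _) (hpos _ _))
  refine (expect_mono _ hpt).trans ?_
  rw [expect_mul_left, expect_add]
  have e1 := hmom θ (abs_of_nonneg hθ0)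
  have e2 := hmom (-θ) (by rw [abs_neg, abs_of_nonneg hθ0])
  have := mul_le_mul_of_nonneg_left (add_le_add e1 e2) (Real.exp_nonneg (-(θ * δ * M / 2)))
  refine this.trans (le_of_eq ?_)
  ring

end deviations
/-! ### The expected degree, given the choices -/

theorem one_sub_mul_rpow_neg_le {α : ℝ} (hα : 0 < α) (hα1 : α < 1) {r : ℝ} (hr : 1 ≤ r) :
    (1 - α) * r ^ (-α) ≤ r ^ (1 - α) - (r - 1) ^ (1 - α) := by
  have hr0 : 0 < r := by linarith
  have h1 : r - 1 = r * (1 + -(1 / r)) := by field_simp; ring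
  have hle : 1 / r ≤ 1 := by rw [div_le_one hr0]; exact hr
  have h2 := rpow_one_add_le_one_add_mul_self (s := -(1 / r)) (by linarith)
    (by linarith : 0 ≤ 1 - α) (by linarith)
  rw [h1, Real.mul_rpow hr0.le (by linarith)]
  have h3 := mul_le_mul_of_nonneg_left h2 (Real.rpow_nonneg hr0.le (1 - α))
  have h4 : r ^ (1 - α) = r * r ^ (-α) := by
    rw [sub_eq_add_neg, Real.rpow_add hr0, Real.rpow_one]
  have h5 : r ^ (1 - α) * (1 + (1 - α) * -(1 / r)) = r ^ (1 - α) - (1 - α) * r ^ (-α) := by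
    rw [h4]
    field_simp
    ring
  linarith

theorem le_one_sub_mul_rpow_neg {α : ℝ} (hα : 0 < α) (hα1 : α < 1) {r : ℝ} (hr : 1 ≤ r) :
    (r + 1) ^ (1 - α) - r ^ (1 - α) ≤ (1 - α) * r ^ (-α) := by
  have hr0 : 0 < r := by linarith
  have h1 : r + 1 = r * (1 + 1 / r) := by field_simp
  have hle : 0 < 1 / r := by positivity
  have h2 := rpow_one_add_le_one_add_mul_self (s := 1 / r) (by linarith)
    (by linarith : 0 ≤ 1 - α) (by linarith)
  rw [h1, Real.mul_rpow hr0.le (by linarith)]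
  have h3 := mul_le_mul_of_nonneg_left h2 (Real.rpow_nonneg hr0.le (1 - α))
  have h4 : r ^ (1 - α) = r * r ^ (-α) := by
    rw [sub_eq_add_neg, Real.rpow_add hr0, Real.rpow_one]
  have h5 : r ^ (1 - α) * (1 + (1 - α) * (1 / r)) = r ^ (1 - α) + (1 - α) * r ^ (-α) := by
    rw [h4]
    field_simp
  linarith

/-- The sum of `r ^ (-α)` over all ranks `r`. -/
noncomputable def rankSum (α : ℝ) (k : ℕ) : ℝ := ∑ x : Fin (k + 1), ((x : ℝ) + 1) ^ (-α)

theorem rankSum_eq (α : ℝ) (k : ℕ) :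
    rankSum α k = ∑ x ∈ Finset.range (k + 1), ((x : ℝ) + 1) ^ (-α) :=
  Fin.sum_univ_eq_sum_range (fun x => ((x : ℝ) + 1) ^ (-α)) (k + 1)

theorem one_sub_mul_rankSum_le {α : ℝ} (hα : 0 < α) (hα1 : α < 1) (k : ℕ) :
    (1 - α) * rankSum α k ≤ ((k : ℝ) + 1) ^ (1 - α) := by
  rw [rankSum_eq]
  have h : ∀ n : ℕ, (1 - α) * ∑ x ∈ Finset.range n, ((x : ℝ) + 1) ^ (-α) ≤ (n : ℝ) ^ (1 - α) := by
    intro n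
    induction n with
    | zero => simpa using Real.rpow_nonneg le_rfl _
    | succ n ih =>
      rw [Finset.sum_range_succ, mul_add]
      have := one_sub_mul_rpow_neg_le hα hα1 (r := (n : ℝ) + 1)
        (by linarith [(Nat.cast_nonneg n : (0 : ℝ) ≤ n)])
      rw [add_sub_cancel_right] at this
      push_cast
      linarith
  simpa using h (k + 1)

theorem le_one_sub_mul_rankSum {α : ℝ} (hα : 0 < α) (hα1 : α < 1) (k : ℕ) :
    ((k : ℝ) + 1) ^ (1 - α) - 1 ≤ (1 - α) * rankSum α k := by
  rw [rankSum_eq]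
  have h : ∀ n : ℕ, ((n : ℝ) + 1) ^ (1 - α) - 1 ≤
      (1 - α) * ∑ x ∈ Finset.range n, ((x : ℝ) + 1) ^ (-α) := by
    intro n
    induction n with
    | zero => simp
    | succ n ih =>
      rw [Finset.sum_range_succ, mul_add]
      have := le_one_sub_mul_rpow_neg hα hα1 (r := (n : ℝ) + 1)
        (by linarith [(Nat.cast_nonneg n : (0 : ℝ) ≤ n)])
      push_cast
      linarith
  refine le_trans ?_ (h (k + 1))
  gcongr
  linarith

section meanDeg

variable {k : ℕ} {α β : ℝ} {p : unitInterval}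

/-- The centered weights `r ^ (-α)`. -/
noncomputable def centeredWeight (α : ℝ) (x : Fin (k + 1)) : ℝ :=
  ((x : ℝ) + 1) ^ (-α) - rankSum α k / ((k : ℝ) + 1)

theorem rpow_neg_le_one {α r : ℝ} (hα : 0 < α) (hr : 1 ≤ r) : r ^ (-α) ≤ 1 :=
  Real.rpow_le_one_of_one_le_of_nonpos hr (by linarith)

theorem rankSum_nonneg (α : ℝ) (k : ℕ) : 0 ≤ rankSum α k :=
  Finset.sum_nonneg fun _ _ => by positivity

theorem rankSum_div_le_one (hα : 0 < α) : rankSum α k / ((k : ℝ) + 1) ≤ 1 := by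
  rw [div_le_one (by positivity), rankSum]
  calc _ ≤ ∑ _x : Fin (k + 1), (1 : ℝ) := Finset.sum_le_sum fun x _ =>
        rpow_neg_le_one hα (by linarith [(Nat.cast_nonneg (x : ℕ) : (0 : ℝ) ≤ (x : ℕ))])
    _ = _ := by simp

theorem abs_centeredWeight_le (hα : 0 < α) (x : Fin (k + 1)) : |centeredWeight α x| ≤ 1 := by
  have h1 : ((x : ℝ) + 1) ^ (-α) ≤ 1 :=
    rpow_neg_le_one hα (by linarith [(Nat.cast_nonneg (x : ℕ) : (0 : ℝ) ≤ (x : ℕ))])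
  have h2 : 0 ≤ ((x : ℝ) + 1) ^ (-α) := by positivity
  have h3 := rankSum_div_le_one (k := k) hα
  have h4 : 0 ≤ rankSum α k / ((k : ℝ) + 1) := div_nonneg (rankSum_nonneg α k) (by positivity)
  rw [centeredWeight, abs_le]
  constructor <;> linarith

theorem sum_centeredWeight (α : ℝ) : ∑ x : Fin (k + 1), centeredWeight α x = 0 := by
  have : (k : ℝ) + 1 ≠ 0 := by positivity
  simp only [centeredWeight, Finset.sum_sub_distrib]
  rw [← rankSum]
  simp
  field_simp
  ring

theorem sum_sq_centeredWeight_le (hα : 0 < α) :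
    ∑ x : Fin (k + 1), centeredWeight α x ^ 2 ≤ rankSum α k := by
  have hk : (0 : ℝ) < (k : ℝ) + 1 := by positivity
  set c := rankSum α k / ((k : ℝ) + 1) with hc
  have hc0 : 0 ≤ c := div_nonneg (rankSum_nonneg α k) hk.le
  calc _ ≤ ∑ x : Fin (k + 1), (((x : ℝ) + 1) ^ (-α) * 1 - c * centeredWeight α x) := by
        refine Finset.sum_le_sum fun x _ => ?_
        have h1 : ((x : ℝ) + 1) ^ (-α) ≤ 1 :=
          rpow_neg_le_one hα (by linarith [(Nat.cast_nonneg (x : ℕ) : (0 : ℝ) ≤ (x : ℕ))])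
        have h2 : 0 ≤ ((x : ℝ) + 1) ^ (-α) := by positivity
        simp only [centeredWeight, ← hc]
        nlinarith
    _ = _ := by
        rw [Finset.sum_sub_distrib, ← Finset.mul_sum, sum_centeredWeight]
        simp [rankSum]

theorem linkProb_eq (x : Fin (k + 1)) :
    linkProb α β p x = p * ((k : ℝ) + 1) ^ (-β) * ((x : ℝ) + 1) ^ (-α) := by
  rw [linkProb, influenceVolume]
  push_cast
  ring

theorem one_sub_mul_rpow_le {δ r R : ℝ} (hα : 0 < α) (hα1 : α < 1) (hδ0 : 0 ≤ δ)
    (hr : 0 < r) (hR : 0 < R) (h : r ≤ (1 + δ) * R) : (1 - δ) * R ^ (-α) ≤ r ^ (-α) := by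
  have h1 : ((1 + δ) * R) ^ (-α) ≤ r ^ (-α) :=
    Real.rpow_le_rpow_of_nonpos hr h (by linarith)
  rw [Real.mul_rpow (by linarith) hR.le] at h1
  have h2 : (1 + δ) ^ (-1 : ℝ) ≤ (1 + δ) ^ (-α) :=
    Real.rpow_le_rpow_of_exponent_le (by linarith) (by linarith)
  have h3 : 1 - δ ≤ (1 + δ) ^ (-1 : ℝ) := by
    rw [Real.rpow_neg_one, ← one_div, le_div_iff₀ (by linarith)]
    nlinarith
  have h4 : 0 ≤ R ^ (-α) := by positivity
  nlinarith [mul_le_mul_of_nonneg_right (h3.trans h2) h4]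

theorem rpow_le_one_add_mul {δ r R : ℝ} (hα : 0 < α) (hα1 : α < 1) (hδ0 : 0 ≤ δ)
    (hδ1 : δ ≤ 1 / 2) (hR : 0 < R) (h : (1 - δ) * R ≤ r) : r ^ (-α) ≤ (1 + 2 * δ) * R ^ (-α) := by
  have hδ : 0 < 1 - δ := by linarith
  have h1 : r ^ (-α) ≤ ((1 - δ) * R) ^ (-α) :=
    Real.rpow_le_rpow_of_nonpos (mul_pos hδ hR) h (by linarith)
  rw [Real.mul_rpow hδ.le hR.le] at h1
  have h2 : (1 - δ) ^ (-α) ≤ (1 - δ) ^ (-1 : ℝ) :=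
    Real.rpow_le_rpow_of_exponent_ge hδ (by linarith) (by linarith)
  have h3 : (1 - δ) ^ (-1 : ℝ) ≤ 1 + 2 * δ := by
    rw [Real.rpow_neg_one, ← one_div, div_le_iff₀ hδ]
    nlinarith
  have h4 : 0 ≤ R ^ (-α) := by positivity
  nlinarith [mul_le_mul_of_nonneg_right (h2.trans h3) h4]

theorem le_add_of_deviations {δ N A B Z J S : ℝ} (hδ : 0 ≤ δ) (hA : 0 ≤ A) (hN : N ≤ A + B)
    (hZ : -(δ * N) ≤ Z) (hJ : A - δ * N ≤ J) (hS : (1 - δ) * B ≤ S) :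
    (1 - 3 * δ) * (A + B) ≤ Z + J + S := by
  linarith [mul_le_mul_of_nonneg_left hN hδ, mul_nonneg hδ hA]

theorem add_le_of_deviations {δ N A B Z J S : ℝ} (hδ : 0 ≤ δ) (hA : 0 ≤ A) (hB : 0 ≤ B)
    (hN : N ≤ A + B) (hZ : Z ≤ δ * N) (hJ : J ≤ A) (hS : S ≤ (1 + 2 * δ) * B) :
    Z + J + S ≤ (1 + 4 * δ) * (A + B) := by
  linarith [mul_le_mul_of_nonneg_left hN hδ, mul_nonneg hδ hA, mul_nonneg hδ hB]

/-- The expected degree is close to the value in the theorem when the ranks are close to the initial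
ranks, and the weights of the older nodes are close to their mean. -/
theorem meanDeg_mem (hα : 0 < α) (hα1 : α < 1) (hp : 0 < (p : ℝ))
    (ρ : Equiv.Perm (Fin (k + 1))) (σ : ℕ → Choice k) (t : ℕ) (j : Fin (k + 1)) {δ M : ℝ}
    (hδ0 : 0 ≤ δ) (hδ1 : δ ≤ 1 / 2) (hM : M ≤ (k : ℝ) + 1)
    (hnew : ∀ u, isNew σ t u = true) (hrank : ∀ i < t, ¬RankDeviates ρ δ M i σ)
    (hold : ∀ τ i, τ + i = t → |∑ u, survivorMark (centeredWeight α) ρ σ τ i u| ≤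
      δ * ((k : ℝ) + 1) ^ (1 - α))
    (hlarge : 2 / (1 - α) ≤ δ * ((k : ℝ) + 1) ^ (1 - α)) :
    let R : ℝ := (birthRank ρ σ t j : ℝ) + 1
    let V : ℝ := degreeValue α β p ((k : ℝ) + 1) ((j : ℝ) + 1) ((max R M / ((k : ℝ) + 1)) ^ (-α))
    p * ((k : ℝ) + 1) ^ (1 - α - β) ≤ V ∧ (1 - 3 * δ) * V ≤ meanDeg α β p ρ σ t j ∧
      (M ≤ R → meanDeg α β p ρ σ t j ≤ (1 + 4 * δ) * V) := by
  intro R V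
  set n : ℝ := (k : ℝ) + 1 with hn
  have hn0 : 0 < n := by positivity
  set N : ℝ := n ^ (1 - α) with hN
  have hN0 : 0 < N := by positivity
  set P : ℝ := p * n ^ (-β) with hP
  have hP0 : 0 < P := by positivity
  set R' := max R M with hR'
  have hR0 : 0 < R := by positivity
  have hR'0 : 0 < R' := lt_max_of_lt_left hR0
  have hRn : R ≤ n := by
    have : (birthRank ρ σ t j : ℕ) ≤ k := Nat.lt_succ_iff.1 (birthRank ρ σ t j).2
    simp only [R, hn]
    gcongr
  have hR'n : R' ≤ n := max_le hRn hM
  set y := (R' / n) ^ (-α) with hy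
  have hy1 : 1 ≤ y := Real.one_le_rpow_of_pos_of_le_one_of_nonpos (by positivity)
    ((div_le_one hn0).2 hR'n) (by linarith)
  set a : ℝ := ((j : ℝ) + 1) / ((1 - α) * n) with ha
  set b : ℝ := (n - ((j : ℝ) + 1)) / n with hb
  have hα' : 0 < 1 - α := by linarith
  have hjk : (j : ℝ) ≤ k := by exact_mod_cast Nat.lt_succ_iff.1 j.2
  have hj0 : (0 : ℝ) ≤ (j : ℝ) := Nat.cast_nonneg _
  have hb0 : 0 ≤ b := div_nonneg (by linarith) hn0.le
  have ha0 : 0 ≤ a := by positivity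
  have hab : 1 ≤ a + b := by
    have : ((j : ℝ) + 1) / n ≤ a := by
      rw [ha]
      gcongr
      nlinarith
    have h2 : ((j : ℝ) + 1) / n + b = 1 := by rw [hb]; field_simp; ring
    linarith
  have hq1 : 1 ≤ a + y * b := by nlinarith
  have hPN : p * n ^ (1 - α - β) = P * N := by
    rw [hP, hN, mul_assoc, ← Real.rpow_add hn0]
    congr 2
    ring
  have hV : V = P * N * (a + y * b) := by
    simp only [V, degreeValue]
    rw [← hPN]
    ring
  obtain ⟨τ, i, hτ, hmark⟩ := exists_survivorMark_eq ρ σ t (hnew j)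
  have hZ := hold τ i hτ
  set Z := ∑ u, survivorMark (centeredWeight α) ρ σ τ i u with hZdef
  set W := rankSum α k with hW
  have hWu : W ≤ N / (1 - α) := by
    rw [le_div_iff₀ hα', mul_comm]
    exact one_sub_mul_rankSum_le hα hα1 k
  have hWl : N / (1 - α) - 1 / (1 - α) ≤ W := by
    rw [← sub_div, div_le_iff₀ hα', mul_comm W]
    exact le_one_sub_mul_rankSum hα hα1 k
  have hW1 : W / n ≤ 1 := rankSum_div_le_one hα
  have holder : ∑ u, (if u < j then linkProb α β p (linkRank ρ σ t u j) else 0) =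
      P * (Z + j * (W / n)) := by
    have e1 : ∀ u, (if u < j then linkProb α β p (linkRank ρ σ t u j) else 0) =
        P * (survivorMark (centeredWeight α) ρ σ τ i u + if u < j then W / n else 0) := by
      intro u
      rw [hmark]
      split_ifs
      · rw [linkProb_eq, centeredWeight]
        ring
      · simp
    have e2 : ∑ u : Fin (k + 1), (if u < j then W / n else 0) = j * (W / n) := by
      rw [← sum_ite_lt j, Finset.sum_mul]
      refine Finset.sum_congr rfl fun u _ => ?_
      split_ifs <;> simp
    simp only [e1]
    rw [← Finset.mul_sum, Finset.sum_add_distrib, e2]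
  set S := ∑ u ∈ Finset.Ioi j, ((linkRank ρ σ t u j : ℝ) + 1) ^ (-α) with hS
  have hμ : meanDeg α β p ρ σ t j = P * (Z + j * (W / n) + S) := by
    have hyounger : ∑ u ∈ Finset.Ioi j, linkProb α β p (linkRank ρ σ t u j) = P * S := by
      rw [hS, Finset.mul_sum]
      exact Finset.sum_congr rfl fun u _ => linkProb_eq _
    rw [meanDeg_eq, holder, hyounger, mul_add P (Z + j * (W / n))]
  have hcard : ((Finset.Ioi j).card : ℝ) = n * b := by
    rw [Fin.card_Ioi, hb, mul_div_cancel₀ _ hn0.ne', hn]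
    have : (j : ℕ) ≤ k := Nat.lt_succ_iff.1 j.2
    push_cast [Nat.cast_sub this, Nat.sub_sub, Nat.add_sub_cancel]
    ring
  have hNy : n * R' ^ (-α) = N * y := by
    rw [hy, Real.div_rpow hR'0.le hn0.le, hN, sub_eq_add_neg, Real.rpow_add hn0, Real.rpow_one]
    have : n ^ (-α) ≠ 0 := by positivity
    field_simp
  have hdev : ∀ u ∈ Finset.Ioi j,
      |((linkRank ρ σ t u j : ℝ) + 1) - R| ≤ δ * R' := by
    intro u hu
    obtain ⟨i', hi', c, h1, h2⟩ := exists_linkRank_of_lt ρ σ t (hnew u) (Finset.mem_Ioi.1 hu)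
    have h3 := hrank i' hi'
    simp only [RankDeviates, not_exists, not_lt] at h3
    have h4 := h3 c
    rwa [← h1, ← h2] at h4
  have hSl : (1 - δ) * (N * y * b) ≤ S := by
    have : ∑ _u ∈ Finset.Ioi j, (1 - δ) * R' ^ (-α) ≤ S := by
      refine Finset.sum_le_sum fun u hu => ?_
      refine one_sub_mul_rpow_le hα hα1 hδ0 (by positivity) hR'0 ?_
      have := (abs_le.1 (hdev u hu)).2
      have := le_max_left R M
      nlinarith
    rw [Finset.sum_const, nsmul_eq_mul, hcard] at this
    calc _ = n * b * ((1 - δ) * R' ^ (-α)) := by rw [← hNy]; ring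
      _ ≤ S := this
  have hSu : M ≤ R → S ≤ (1 + 2 * δ) * (N * y * b) := by
    intro hMR
    have hRR : R' = R := max_eq_left hMR
    have : S ≤ ∑ _u ∈ Finset.Ioi j, (1 + 2 * δ) * R' ^ (-α) := by
      refine Finset.sum_le_sum fun u hu => ?_
      refine rpow_le_one_add_mul hα hα1 hδ0 hδ1 hR'0 ?_
      have := (abs_le.1 (hdev u hu)).1
      rw [hRR] at this ⊢
      linarith
    rw [Finset.sum_const, nsmul_eq_mul, hcard] at this
    calc S ≤ n * b * ((1 + 2 * δ) * R' ^ (-α)) := this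
      _ = _ := by rw [← hNy]; ring
  have hNa : N * a = ((j : ℝ) + 1) / n * (N / (1 - α)) := by
    rw [ha]
    field_simp
  have hjn : ((j : ℝ) + 1) / n ≤ 1 := by rw [div_le_one hn0]; linarith
  have hjn0 : 0 ≤ ((j : ℝ) + 1) / n := by positivity
  have hjW : (j : ℝ) * (W / n) = ((j : ℝ) + 1) / n * W - W / n := by ring
  have hWn0 : 0 ≤ W / n := div_nonneg (rankSum_nonneg α k) hn0.le
  have hinv : 1 ≤ 1 / (1 - α) := by rw [le_div_iff₀ hα']; linarith
  have h2inv : 2 / (1 - α) = 2 * (1 / (1 - α)) := by ring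
  have hWa : (j : ℝ) * (W / n) ≤ N * a := by
    rw [hjW, hNa]
    linarith [mul_le_mul_of_nonneg_left hWu hjn0]
  have hWb : N * a - δ * N ≤ (j : ℝ) * (W / n) := by
    rw [hjW, hNa]
    have e1 := mul_le_mul_of_nonneg_left hWl hjn0
    have e2 := mul_le_mul_of_nonneg_right hjn (by positivity : 0 ≤ 1 / (1 - α))
    rw [mul_sub] at e1
    linarith
  have hZ' := abs_le.1 hZ
  have hA0 : 0 ≤ N * a := by positivity
  have hB0 : 0 ≤ N * y * b := by positivity
  have hNAB : N ≤ N * a + N * y * b := by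
    rw [mul_assoc, ← mul_add]
    exact le_mul_of_one_le_right hN0.le hq1
  rw [hV, hμ, hPN]
  clear_value P N a b y Z S
  refine ⟨?_, ?_, fun hMR => ?_⟩
  · exact le_mul_of_one_le_right (by positivity) hq1
  · calc _ = P * ((1 - 3 * δ) * (N * a + N * y * b)) := by ring
      _ ≤ _ := mul_le_mul_of_nonneg_left
        (le_add_of_deviations hδ0 hA0 hNAB hZ'.1 hWb hSl) hP0.le
  · calc _ ≤ P * ((1 + 4 * δ) * (N * a + N * y * b)) := mul_le_mul_of_nonneg_left
          (add_le_of_deviations hδ0 hA0 hB0 hNAB hZ'.2 hWa (hSu hMR)) hP0.le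
      _ = _ := by ring

end meanDeg
/-! ### The degree estimate for bounded times -/

section degree

open scoped ENNReal

variable {m k : ℕ} {α β : ℝ} {p : unitInterval}

theorem sqrt_mul_log_sq_div_rpow (α : ℝ) {n l : ℝ} (hn : 0 < n) (hl : 0 < l) :
    (√n * l ^ 2 / n) ^ (-α) = n ^ (α / 2) * l ^ (-(2 * α)) := by
  have h1 : √n * l ^ 2 / n = n ^ (-(1 / 2) : ℝ) * l ^ (2 : ℝ) := by
    rw [Real.sqrt_eq_rpow, Real.rpow_two, mul_div_right_comm]
    congr 1
    rw [div_eq_iff hn.ne', ← Real.rpow_add_one hn.ne']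
    norm_num
  rw [h1, Real.mul_rpow (by positivity) (by positivity), ← Real.rpow_mul hn.le,
    ← Real.rpow_mul hl.le]
  congr 2 <;> ring

theorem deg_bounds_of_deviations {D μ V δ : ℝ} (hδ0 : 0 ≤ δ) (hδ1 : δ ≤ 1 / 6) (hV : 0 ≤ V)
    (hD : |D - μ| ≤ δ * μ) (hμ : (1 - 3 * δ) * V ≤ μ) :
    (1 - 10 * δ) * V ≤ D ∧ (μ ≤ (1 + 4 * δ) * V → |D - V| ≤ 10 * δ * V) := by
  have h := abs_le.1 hD
  have h1 : (1 - δ) * ((1 - 3 * δ) * V) ≤ (1 - δ) * μ :=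
    mul_le_mul_of_nonneg_left hμ (by linarith)
  have h2 : 0 ≤ δ * V := mul_nonneg hδ0 hV
  have h3 : 0 ≤ δ * (δ * V) := mul_nonneg hδ0 h2
  have h4 : (1 - 10 * δ) * V ≤ D := by nlinarith
  refine ⟨h4, fun hμ' => abs_le.2 ⟨by linarith, ?_⟩⟩
  have h5 : (1 + δ) * μ ≤ (1 + δ) * ((1 + 4 * δ) * V) :=
    mul_le_mul_of_nonneg_left hμ' (by linarith)
  have h6 : δ * (δ * V) ≤ 1 / 6 * (δ * V) := mul_le_mul_of_nonneg_right hδ1 h2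
  nlinarith

theorem mem_degreeEvent {s x : State m k} {σ : ℕ → Choice k} {L : ℕ} (hx : Compatible s σ L x)
    (j : Fin (k + 1)) (hnew : isNew σ L j = true) (hlog : 0 < Real.log ((k : ℝ) + 1))
    {δ M : ℝ} (hδ : δ = Real.log ((k : ℝ) + 1) ^ (-(1 / 2) : ℝ)) (hδ1 : δ ≤ 1 / 6)
    (hM : M = √((k : ℝ) + 1) * Real.log ((k : ℝ) + 1) ^ 2) {μ : ℝ}
    (hD : |(x.deg j : ℝ) - μ| ≤ δ * μ)
    (hμ : let R : ℝ := (birthRank s.2.rank σ L j : ℝ) + 1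
      let V : ℝ := degreeValue α β p ((k : ℝ) + 1) ((j : ℝ) + 1)
        ((max R M / ((k : ℝ) + 1)) ^ (-α))
      0 ≤ V ∧ (1 - 3 * δ) * V ≤ μ ∧ (M ≤ R → μ ≤ (1 + 4 * δ) * V)) :
    x ∈ (degreeEvent α β p 10 j : Set (State m k)) := by
  have hδ0 : 0 ≤ δ := by rw [hδ]; positivity
  have hR : (x.initRk j : ℝ) = (birthRank s.2.rank σ L j : ℝ) + 1 := by
    rw [State.initRk, hx.2, birthRank,
      markAt_congr_of_isNew s.2.initRank s.2.rank Prod.snd σ L j hnew]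
    push_cast
    rfl
  obtain ⟨hV0, hl, hu⟩ := hμ
  obtain ⟨h1, h2⟩ := deg_bounds_of_deviations hδ0 hδ1 hV0 hD hl
  simp only [degreeEvent, Set.mem_ofPred_eq]
  rw [hR, ← hδ, ← hM]
  refine ⟨fun hMR => ?_, fun hRM => ?_⟩
  · rw [max_eq_left hMR] at h2 hu
    exact h2 (hu hMR)
  · rw [max_eq_right hRM.le, hM, sqrt_mul_log_sq_div_rpow α (by positivity) hlog] at h1
    exact h1

theorem adaptedTo_rankDeviates (ρ : Equiv.Perm (Fin (k + 1))) (δ M : ℝ) (t : ℕ) :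
    AdaptedTo t (RankDeviates ρ δ M t) := by
  intro σ σ' h
  have h1 := adaptedTo_rankAt ρ t σ σ' h
  have h2 := adaptedTo_markAt ρ Prod.snd t σ σ' h
  simp only at h1 h2
  simp only [RankDeviates, birthRank, h1, h2]

open scoped Classical in
theorem lawAt_compl_degreeEvent_le (hm : 0 < m) (hα : 0 < α) (hα1 : α < 1) (hβ : 0 ≤ β)
    (hp : 0 < (p : ℝ)) (hlog : 0 < Real.log ((k : ℝ) + 1)) {δ M θ θ' η : ℝ} {T : ℕ}
    (hδ : δ = Real.log ((k : ℝ) + 1) ^ (-(1 / 2) : ℝ)) (hδ1 : δ ≤ 1 / 6)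
    (hM : M = √((k : ℝ) + 1) * Real.log ((k : ℝ) + 1) ^ 2) (hMk : M ≤ (k : ℝ) + 1)
    (hlarge : 2 / (1 - α) ≤ δ * ((k : ℝ) + 1) ^ (1 - α))
    (hθ0 : 0 < θ) (hθ1 : 2 * θ ≤ 1) (hθ : 16 * θ * T ≤ δ * ((k : ℝ) + 1))
    (hθ'0 : 0 ≤ θ') (hθ'1 : θ' ≤ 1)
    (h1 : T * (6 * (((k : ℝ) + 1) + T) * Real.exp (-(θ * δ * M / 2))) ≤ η)
    (h2 : ((T : ℝ) + 1) * (2 * Real.exp (-(θ' * (δ * ((k : ℝ) + 1) ^ (1 - α))) +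
      θ' ^ 2 * rankSum α k)) ≤ η)
    (h3 : 2 * Real.exp (-(δ ^ 2 * (p * ((k : ℝ) + 1) ^ (1 - α - β) / 2) / 4)) ≤ η)
    (s : State m k) {L : ℕ} (hL : L ≤ T) (j : Fin (k + 1)) :
    (lawAt α β p s L).real (degreeEvent α β p 10 j)ᶜ ≤
      ((k : ℝ) + 1) * Real.exp (-((L : ℝ) / ((k : ℝ) + 1))) + 3 * η := by
  have hδ0 : 0 ≤ δ := by rw [hδ]; positivity
  have hη : 0 ≤ η := le_trans (by positivity) h3
  have hLT : (L : ℝ) ≤ T := by exact_mod_cast hL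
  set ρ := s.2.rank with hρ
  set y := δ * ((k : ℝ) + 1) ^ (1 - α) with hy
  have hmeas : MeasurableSet (degreeEvent α β p 10 j : Set (State m k))ᶜ :=
    (measurableSet_degreeEvent α β p 10 j).compl
  set f : State m k → ℝ≥0∞ := (degreeEvent α β p 10 j : Set (State m k))ᶜ.indicator 1 with hf
  have hf1 : ∀ x, f x ≤ 1 := fun x => Set.indicator_le_self' (fun _ _ => zero_le) x
  rw [measureReal_def, ← lintegral_indicator_one hmeas,
    toReal_lintegral_lawAt s L (measurable_one.indicator hmeas) hf1]
  have hpt : ∀ σ : ℕ → Choice k, (condMean α β p s σ L f).toReal ≤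
      (if ∃ u, isNew σ L u = false then 1 else 0) +
      (∑ t ∈ Finset.range L, if RankDeviates ρ δ M t σ then 1 else 0) +
      (∑ τ ∈ Finset.range (L + 1),
        if y < |∑ u, survivorMark (centeredWeight α) ρ σ τ (L - τ) u| then 1 else 0) + η := by
    intro σ
    have p1 : (0 : ℝ) ≤ if ∃ u, isNew σ L u = false then 1 else 0 := by split_ifs <;> simp
    have p2 : ∀ t ∈ Finset.range L, (0 : ℝ) ≤ if RankDeviates ρ δ M t σ then 1 else 0 :=
      fun t _ => by split_ifs <;> simp
    have p3 : ∀ τ ∈ Finset.range (L + 1), (0 : ℝ) ≤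
        if y < |∑ u, survivorMark (centeredWeight α) ρ σ τ (L - τ) u| then 1 else 0 :=
      fun t _ => by split_ifs <;> simp
    have q2 := Finset.sum_nonneg p2
    have q3 := Finset.sum_nonneg p3
    have hle : (condMean α β p s σ L f).toReal ≤ 1 :=
      ENNReal.toReal_mono ENNReal.one_ne_top (condMean_le_one hf1)
    by_cases c1 : ∃ u, isNew σ L u = false
    · rw [if_pos c1] at p1 ⊢
      linarith
    by_cases c2 : ∃ t < L, RankDeviates ρ δ M t σ
    · obtain ⟨t, ht, hd⟩ := c2
      have := Finset.single_le_sum p2 (Finset.mem_range.2 ht)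
      rw [if_pos hd] at this
      linarith
    by_cases c3 : ∃ τ < L + 1, y < |∑ u, survivorMark (centeredWeight α) ρ σ τ (L - τ) u|
    · obtain ⟨τ, hτ, hd⟩ := c3
      have := Finset.single_le_sum p3 (Finset.mem_range.2 hτ)
      rw [if_pos hd] at this
      linarith
    simp only [not_exists, Bool.not_eq_false] at c1
    simp only [not_exists, not_and] at c2
    simp only [not_exists, not_and, not_lt] at c3
    have hμ := meanDeg_mem (β := β) hα hα1 hp ρ σ L j hδ0 (by linarith) hMk c1 c2
      (fun τ i hτ => by
        have := c3 τ (by omega)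
        rwa [show L - τ = i by omega] at this) hlarge
    simp only at hμ
    obtain ⟨hV, hl, hu⟩ := hμ
    set V := degreeValue α β p ((k : ℝ) + 1) ((j : ℝ) + 1)
      ((max ((birthRank ρ σ L j : ℝ) + 1) M / ((k : ℝ) + 1)) ^ (-α)) with hVdef
    set μ := meanDeg α β p ρ σ L j with hμdef
    have hX0 : 0 ≤ p * ((k : ℝ) + 1) ^ (1 - α - β) := by positivity
    have hV0 : 0 ≤ V := hX0.trans hV
    have hμX : p * ((k : ℝ) + 1) ^ (1 - α - β) / 2 ≤ μ := by nlinarith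
    have hbad : condMean α β p s σ L f ≤ ENNReal.ofReal η := by
      refine (condMean_mono fun x hx => ?_).trans ((condMean_deg_deviation_le (p := p) hm hα.le hβ s
        σ L c1 j hδ0 (by linarith)).trans (ENNReal.ofReal_le_ofReal (le_trans ?_ h3)))
      · by_cases hd : δ * μ < |(x.deg j : ℝ) - μ|
        · rw [if_pos hd]
          exact hf1 x
        · have hmem := mem_degreeEvent (α := α) (β := β) (p := p) hx j (c1 j) hlog hδ hδ1 hM
            (not_lt.1 hd) ⟨hV0, hl, hu⟩
          simp [hf, hmem]
      · rw [← hρ, ← hμdef]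
        gcongr
    have := ENNReal.toReal_mono ENNReal.ofReal_ne_top hbad
    rw [ENNReal.toReal_ofReal hη] at this
    linarith
  refine (expect_mono L hpt).trans ?_
  rw [expect_add, expect_add, expect_add, expect_sum, expect_sum, expect_const]
  have b1 := expect_exists_old_le (k := k) L
  have b2 : ∑ t ∈ Finset.range L,
      expect L (fun σ => if RankDeviates ρ δ M t σ then (1 : ℝ) else 0) ≤ η := by
    refine le_trans ?_ h1
    calc _ ≤ ∑ _t ∈ Finset.range L,
          6 * (((k : ℝ) + 1) + T) * Real.exp (-(θ * δ * M / 2)) := by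
          refine Finset.sum_le_sum fun t ht => ?_
          have htL := (Finset.mem_range.1 ht).le
          rw [expect_of_adaptedTo ((adaptedTo_rankDeviates ρ δ M t).comp
            fun P => if P then (1 : ℝ) else 0) htL]
          exact expect_rankDeviates_le ρ hδ0 (by linarith) hθ0 hθ1 hθ (htL.trans hL)
      _ ≤ _ := by
          rw [Finset.sum_const, Finset.card_range, nsmul_eq_mul]
          gcongr
  have b3 : ∑ τ ∈ Finset.range (L + 1), expect L (fun σ =>
      if y < |∑ u, survivorMark (centeredWeight α) ρ σ τ (L - τ) u| then (1 : ℝ) else 0) ≤ η := by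
    refine le_trans ?_ h2
    calc _ ≤ ∑ _τ ∈ Finset.range (L + 1),
          (2 * Real.exp (-(θ' * y) + θ' ^ 2 * rankSum α k)) := by
          refine Finset.sum_le_sum fun τ hτ => ?_
          have hτL : τ + (L - τ) = L := by have := Finset.mem_range.1 hτ; omega
          have := expect_survivorMark_deviation_le (abs_centeredWeight_le hα)
            (sum_centeredWeight α) ρ τ (L - τ) (y := y) hθ'0 hθ'1
          rw [hτL] at this
          refine this.trans ?_
          gcongr
          exact sum_sq_centeredWeight_le hα
      _ ≤ _ := by
          rw [Finset.sum_const, Finset.card_range, nsmul_eq_mul]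
          push_cast
          gcongr
  linarith

end degree
/-! ### The choice of the parameters -/

theorem eventually_mul_log_pow_le (K : ℝ) {a : ℝ} (ha : 0 < a) :
    ∀ᶠ x : ℝ in Filter.atTop, K * Real.log x ^ 3 ≤ x ^ a := by
  have h := (isLittleO_log_rpow_rpow_atTop 3 ha).bound
    (c := 1 / (|K| + 1)) (by positivity)
  filter_upwards [h, Filter.eventually_ge_atTop 1] with x hx hx1
  have hl : 0 ≤ Real.log x := Real.log_nonneg hx1
  have h3 : Real.log x ^ (3 : ℝ) = Real.log x ^ 3 := by
    rw [← Real.rpow_natCast]; norm_num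
  rw [h3, Real.norm_of_nonneg (by positivity), Real.norm_of_nonneg (by positivity)] at hx
  have hK : (0 : ℝ) < |K| + 1 := by positivity
  calc K * Real.log x ^ 3 ≤ (|K| + 1) * Real.log x ^ 3 := by
        gcongr
        linarith [le_abs_self K]
    _ ≤ (|K| + 1) * (1 / (|K| + 1) * x ^ a) := by gcongr
    _ = x ^ a := by field_simp

theorem exp_log_bound {n l A x : ℝ} (i : ℕ) (hn : 0 < n) (hl : l = Real.log n)
    (hA : A ≤ n ^ i) (hx : l ^ 2 + i * l ≤ x) : A * Real.exp (-x) ≤ Real.exp (-l ^ 2) := by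
  have h1 : n ^ i = Real.exp (i * l) := by
    rw [Real.exp_nat_mul, hl, Real.exp_log hn]
  calc A * Real.exp (-x) ≤ n ^ i * Real.exp (-x) := by gcongr
    _ = Real.exp (i * l + -x) := by rw [h1, ← Real.exp_add]
    _ ≤ _ := by gcongr; linarith

set_option maxHeartbeats 800000 in
theorem lawAt_compl_degreeEvent_le_of_large {m : ℕ} {α β : ℝ} {p : unitInterval} (hm : 0 < m)
    (hα : 0 < α) (hα1 : α < 1) (hβ : 0 ≤ β) (hp : 0 < (p : ℝ)) {k : ℕ} {n l : ℝ}
    (hn : n = (k : ℝ) + 1) (hl : l = Real.log n) (hl36 : 36 ≤ l)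
    (hsqrt : 200 * l ^ 3 ≤ √n) (hN : 8 / (1 - α) * l ^ 3 ≤ n ^ (1 - α))
    (hX : 16 / p * l ^ 3 ≤ n ^ (1 - α - β)) (s : State m k) {L : ℕ}
    (hL : L ≤ ⌈2 * n * l ^ 2⌉₊) (j : Fin (k + 1)) :
    (lawAt α β p s L).real (degreeEvent α β p 10 j)ᶜ ≤
      n * Real.exp (-((L : ℝ) / n)) + 3 * Real.exp (-l ^ 2) := by
  have hn1 : 1 ≤ n := by rw [hn]; linarith [(Nat.cast_nonneg k : (0 : ℝ) ≤ k)]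
  have hn0 : 0 < n := by linarith
  have hl0 : 0 < l := by linarith
  have hα' : 0 < 1 - α := by linarith
  have hl3 : 36 ^ 2 * l ≤ l ^ 3 := by
    have : 36 ^ 2 ≤ l ^ 2 := by gcongr
    nlinarith
  have hl23 : 36 * l ^ 2 ≤ l ^ 3 := by nlinarith [sq_nonneg l]
  have hsq : √n * √n = n := Real.mul_self_sqrt hn0.le
  have hsq1 : 1 ≤ √n := Real.one_le_sqrt.2 hn1
  have hsqn : √n ≤ n := by nlinarith
  set T := ⌈2 * n * l ^ 2⌉₊ with hT
  have hT1 : 2 * n * l ^ 2 ≤ T := Nat.le_ceil _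
  have hT2 : (T : ℝ) ≤ 3 * n * l ^ 2 := by
    have h1 := (Nat.ceil_lt_add_one (by positivity : 0 ≤ 2 * n * l ^ 2)).le
    have h2 : 1 ≤ n * l ^ 2 := by nlinarith
    linarith
  have hT0 : (0 : ℝ) < T := lt_of_lt_of_le (by positivity) hT1
  have hnT : n ≤ T := by
    have : n * 1 ≤ n * (2 * l ^ 2) := by
      gcongr
      nlinarith
    linarith
  have hTn : (T : ℝ) ≤ n ^ 2 := by
    have : 3 * l ^ 2 ≤ n := by linarith
    nlinarith
  set δ : ℝ := l ^ (-(1 / 2) : ℝ) with hδ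
  have hδ0 : 0 < δ := by positivity
  have hδsq : δ ^ 2 = 1 / l := by
    rw [hδ, ← Real.rpow_natCast, ← Real.rpow_mul hl0.le]
    norm_num [Real.rpow_neg_one]
  have hδ6 : δ ≤ 1 / 6 := by
    refine le_of_sq_le_sq ?_ (by norm_num)
    rw [hδsq]
    rw [div_le_iff₀ hl0]
    linarith
  have hδl : 1 / l ≤ δ := by rw [← hδsq]; nlinarith
  set N : ℝ := n ^ (1 - α) with hNdef
  have hN0 : 0 < N := by positivity
  have hNl : 8 * l ^ 3 ≤ (1 - α) * N := by
    rw [div_mul_eq_mul_div, div_le_iff₀ hα'] at hN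
    linarith
  have hXl : 16 * l ^ 3 ≤ p * n ^ (1 - α - β) := by
    rw [div_mul_eq_mul_div, div_le_iff₀ hp] at hX
    linarith
  have hn12 : 12 ≤ n := by linarith
  have key := lawAt_compl_degreeEvent_le (k := k) (β := β) (δ := δ) (M := √n * l ^ 2)
    (θ := δ * n / (16 * T)) (θ' := (1 - α) * δ / 2) (η := Real.exp (-l ^ 2)) (T := T)
    hm hα hα1 hβ hp (by rw [← hn, ← hl]; exact hl0) (by rw [← hn, ← hl]) hδ6
    (by rw [← hn, ← hl]) (by rw [← hn]; nlinarith)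
  rw [← hn] at key
  refine key ?_ (by positivity) ?_ ?_ (by positivity) ?_ ?_ ?_ ?_ s hL j
  · rw [div_le_iff₀ hα']
    have : 1 / l * N ≤ δ * N := by gcongr
    have h2 : 2 ≤ 1 / l * ((1 - α) * N) := by
      rw [div_mul_eq_mul_div, le_div_iff₀ hl0]
      linarith
    nlinarith
  · rw [mul_div_assoc', div_le_one (by positivity)]
    have h1 : δ * n ≤ 1 / 6 * n := by gcongr
    linarith
  · rw [le_iff_lt_or_eq]
    right
    field_simp
  · linarith [mul_le_mul_of_nonneg_left hδ6 hα'.le]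
  · have hx : √n / (96 * l) ≤ δ * n / (16 * T) * δ * (√n * l ^ 2) / 2 := by
      have e : δ * n / (16 * T) * δ * (√n * l ^ 2) / 2 = √n * n * l / (32 * T) := by
        have : δ * n / (16 * T) * δ * (√n * l ^ 2) / 2 =
            δ ^ 2 * (n * √n * l ^ 2 / (32 * T)) := by
          field_simp
          ring
        rw [this, hδsq]
        field_simp
      rw [e, div_le_div_iff₀ (by positivity) (by positivity)]
      nlinarith [mul_le_mul_of_nonneg_left hT2 (Real.sqrt_nonneg n)]
    rw [← mul_assoc]
    refine exp_log_bound 5 hn0 hl ?_ (le_trans ?_ hx)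
    · calc (T : ℝ) * (6 * (n + T)) ≤ n ^ 2 * (6 * (n ^ 2 + n ^ 2)) := by
            gcongr
            nlinarith
        _ = 12 * n ^ 4 := by ring
        _ ≤ n * n ^ 4 := by gcongr
        _ = n ^ 5 := by ring
    · rw [le_div_iff₀ (by positivity)]
      push_cast
      nlinarith
  · have hW := one_sub_mul_rankSum_le hα hα1 k
    rw [← hn] at hW
    rw [← mul_assoc, show -((1 - α) * δ / 2 * (δ * N)) + ((1 - α) * δ / 2) ^ 2 * rankSum α k =
      -((1 - α) * δ / 2 * (δ * N) - ((1 - α) * δ / 2) ^ 2 * rankSum α k) by ring]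
    refine exp_log_bound 3 hn0 hl ?_ ?_
    · nlinarith
    · have e1 : (1 - α) * δ / 2 * (δ * N) - ((1 - α) * δ / 2) ^ 2 * rankSum α k =
          (1 - α) / (4 * l) * (2 * N - (1 - α) * rankSum α k) := by
        have : (1 - α) * δ / 2 * (δ * N) - ((1 - α) * δ / 2) ^ 2 * rankSum α k =
          δ ^ 2 * ((1 - α) / 4 * (2 * N - (1 - α) * rankSum α k)) := by ring
        rw [this, hδsq]
        field_simp
      rw [e1]
      calc l ^ 2 + (3 : ℕ) * l ≤ 1 / (4 * l) * (8 * l ^ 3) := by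
            rw [div_mul_eq_mul_div, le_div_iff₀ (by positivity)]
            push_cast
            nlinarith
        _ ≤ 1 / (4 * l) * ((1 - α) * N) := by gcongr
        _ = (1 - α) / (4 * l) * N := by ring
        _ ≤ _ := by gcongr; linarith
  · refine exp_log_bound 1 hn0 hl (by linarith) ?_
    rw [hδsq]
    calc l ^ 2 + (1 : ℕ) * l ≤ 1 / l * (16 * l ^ 3 / 2) / 4 := by
          rw [show 1 / l * (16 * l ^ 3 / 2) / 4 = 2 * l ^ 2 by field_simp; ring]
          push_cast
          nlinarith
      _ ≤ _ := by gcongr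

end GeoP

open GeoP in
theorem theorem4p4 (α β : ℝ) (m : ℕ) (p : unitInterval)
    (hα : α ∈ Set.Ioo (0 : ℝ) 1) (hβ : β ∈ Set.Ioo (0 : ℝ) (1 - α)) (hm : 0 < m) (hp : 0 < p) :
    ∃ C : ℝ, 0 < C ∧ ∃ c : ℝ, 0 < c ∧ ∃ N : ℕ, ∀ k : ℕ, N ≤ k → ∀ j : Fin (k + 1),
      (∀ μ : Measure (GeoP.State m k), GeoP.IsStationary α β p μ →
        1 - Real.exp (-(c * Real.log ((k : ℝ) + 1) ^ 2)) ≤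
          μ.real (GeoP.degreeEvent α β p C j)) ∧
      (∀ (s : GeoP.State m k) (L : ℕ),
        1 - Real.exp (-(c * Real.log ((k : ℝ) + 1) ^ 2))
            - ((k : ℝ) + 1) * Real.exp (-((L : ℝ) / ((k : ℝ) + 1))) ≤
          (GeoP.lawAt α β p s L).real (GeoP.degreeEvent α β p C j)) := by
  have hp' : 0 < (p : ℝ) := hp
  have hev : ∀ᶠ x : ℝ in Filter.atTop, 36 ≤ Real.log x ∧ 200 * Real.log x ^ 3 ≤ √x ∧
      8 / (1 - α) * Real.log x ^ 3 ≤ x ^ (1 - α) ∧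
      16 / p * Real.log x ^ 3 ≤ x ^ (1 - α - β) := by
    filter_upwards [Real.tendsto_log_atTop.eventually_ge_atTop 36,
      eventually_mul_log_pow_le 200 (a := 1 / 2) (by norm_num),
      eventually_mul_log_pow_le (8 / (1 - α)) (a := 1 - α) (by linarith [hα.2]),
      eventually_mul_log_pow_le (16 / p) (a := 1 - α - β) (by linarith [hβ.2])] with x h1 h2 h3 h4
    exact ⟨h1, by rwa [Real.sqrt_eq_rpow], h3, h4⟩
  have hev' := (Filter.tendsto_atTop_add_const_right Filter.atTop (1 : ℝ)
    tendsto_natCast_atTop_atTop).eventually hev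
  obtain ⟨N, hN⟩ := Filter.eventually_atTop.1 hev'
  refine ⟨10, by norm_num, 1 / 2, by norm_num, N, fun k hk j => ?_⟩
  obtain ⟨hl36, hsqrt, hN1, hX⟩ := hN k hk
  set n : ℝ := (k : ℝ) + 1 with hn
  have hn0 : 0 < n := by positivity
  set l := Real.log n with hl
  set T := ⌈2 * n * l ^ 2⌉₊ with hT
  have hbase : ∀ (s : State m k) {L : ℕ}, L ≤ T →
      (lawAt α β p s L).real (degreeEvent α β p 10 j)ᶜ ≤
        n * Real.exp (-((L : ℝ) / n)) + 3 * Real.exp (-l ^ 2) := fun s L hL =>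
    lawAt_compl_degreeEvent_le_of_large hm hα.1 hα.2 hβ.1.le hp' hn hl hl36 hsqrt hN1 hX s hL j
  have hfour : 4 * Real.exp (-l ^ 2) ≤ Real.exp (-(1 / 2 * l ^ 2)) := by
    have h1 : Real.exp (-l ^ 2) = Real.exp (-(1 / 2 * l ^ 2)) * Real.exp (-(1 / 2 * l ^ 2)) := by
      rw [← Real.exp_add]; congr 1; ring
    have h2 : Real.exp (-(1 / 2 * l ^ 2)) ≤ 1 / 4 := by
      rw [Real.exp_neg, ← one_div]
      refine one_div_le_one_div_of_le (by norm_num) ?_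
      have := Real.add_one_le_exp (1 / 2 * l ^ 2)
      nlinarith
    rw [h1]
    nlinarith [Real.exp_nonneg (-(1 / 2 * l ^ 2))]
  have hlate : ∀ μ : Measure (State m k), IsProbabilityMeasure μ →
      ((evolve α β p)^[T] μ).real (degreeEvent α β p 10 j)ᶜ ≤ Real.exp (-(1 / 2 * l ^ 2)) := by
    intro μ hμ
    refine iterate_evolve_real_le μ T (measurableSet_degreeEvent α β p 10 j).compl fun s => ?_
    refine (hbase s le_rfl).trans (le_trans ?_ hfour)
    have h1 : n * Real.exp (-((T : ℝ) / n)) ≤ Real.exp (-l ^ 2) := by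
      refine exp_log_bound 1 hn0 hl (by simp) ?_
      have h2 : 2 * n * l ^ 2 ≤ T := Nat.le_ceil _
      rw [le_div_iff₀ hn0]
      push_cast
      nlinarith [mul_nonneg hn0.le (mul_nonneg (by linarith : 0 ≤ l) (by linarith : 0 ≤ l - 1))]
    linarith
  have hcompl : ∀ (μ : Measure (State m k)) [IsProbabilityMeasure μ],
      μ.real (degreeEvent α β p 10 j) = 1 - μ.real (degreeEvent α β p 10 j)ᶜ := fun μ _ => by
    rw [probReal_compl_eq_one_sub (measurableSet_degreeEvent α β p 10 j)]
    ring
  refine ⟨fun μ hμ => ?_, fun s L => ?_⟩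
  · have := hμ.1
    have h := hlate μ hμ.1
    rw [Function.iterate_fixed hμ.2 T] at h
    rw [hcompl]
    linarith
  · rw [hcompl]
    have hpos : 0 ≤ n * Real.exp (-((L : ℝ) / n)) := by positivity
    rcases le_total L T with hLT | hLT
    · have := hbase s hLT
      linarith [Real.exp_nonneg (-l ^ 2)]
    · have h := hlate (lawAt α β p s (L - T)) inferInstance
      have e : (evolve α β p)^[T] (lawAt α β p s (L - T)) = lawAt α β p s L := by
        rw [lawAt, ← Function.iterate_add_apply, Nat.add_sub_cancel' hLT, lawAt]
      rw [e] at h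
      linarith
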